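/- **Setting.** Let $S\subseteq\mathbb{R}^d$ be convex and compact, let $\mathcal{V}\subseteq\mathbb{R}^m$ be closed and convex with $0\in\mathcal{V}$, let $\|\cdot\|$ be an arbitrary norm on $\mathbb{R}^m$ with dual norm $\|\cdot\|_*$, and let $u:\mathbb{R}^m\to\mathbb{R}$ be concave and Lipschitz with $u(0)=0$. Triples $(x_t,r_t,V_t)$, $t=1,2,\dots$, are i.i.d. from a distribution $\mathbb{P}$, where $x_t$ is a feature, $\mu_t=(r_t,V_t)\in\mathbb{R}^d\times\mathbb{R}^{d\times m}$ is integrable, and $g^*(x)=\mathbb{E}[\mu\mid x]$. Put $d_{\mathcal V}(v)=\inf_{v'\in\mathcal V}\|v-v'\|$, let $\Lambda,\Theta\subseteq\mathbb{R}^m$ be the domains of the Fenchel conjugates $(-u)^*$ and $d_{\mathcal V}^*$, and let $B_{\mathcal V}\in[0,\infty]$ be the distance from $0$ to the boundary of $\mathcal V$ ($\infty$ if $\mathcal V=\mathbb{R}^m$). The benchmark is $$\mathrm{OPT}=\sup_\pi\{\mathbb{E}[r^T\pi(x)]+u(\mathbb{E}[V^T\pi(x)])\}\quad\text{over measurable }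 \pi \text{ with values in } S \text{ and } \mathbb{E}[V^T\pi(x)]\in\mathcal V,$$ and at least one such $\pi$ is assumed to exist. **Algorithm.** Fix $\zeta>0$. For $\omega=(\lambda,\theta)$ and $\mu=(r,V)$ let $c(\mu;\omega)=r-V\lambda-\zeta V\theta$; let $w^*(\mu;\omega)\in\arg\max_{w\in S}c(\mu;\omega)^Tw$ be a measurable oracle; let $\ell$ be a surrogate loss, $\mathcal H$ a class of predictors $x\mapsto(\hat r,\hat V)$, and $\hat g^n_\omega\in\arg\min_{g\in\mathcal H}\sum_{i=1}^n\ell(c(g(x_i);\omega),c(\mu_i;\omega))$ a (measurable) empirical risk minimizer. Let $h_\Lambda,h_\Theta$ be differentiable and $1$-strongly convex with respect to $\|\cdot\|_*$ on $\Lambda,\Theta$, with Bregman distances bounded by $D_\Lambda$, $D_\Theta$. Start from a prediction model $g_1$ and $\omega_1=(\lambda_1,\theta_1)\in\Lambda\times\Theta$. In round $t\le T$ decide $w_t=w^*(g_t(x_t);\omega_t)$, with consumption $v_t=V_t^Tw_t$; choose subgradients $s_t$ of $\xi_t(\lambda)=-v_t^T\lambda+(-u)^*(\lambda)$ on $\Lambda$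 at $\lambda_t$ and $s_t'$ of $\phi_t(\theta)=-v_t^T\theta+d_{\mathcal V}^*(\theta)$ on $\Theta$ at $\theta_t$; set $$\lambda_{t+1}\in\arg\min_{\lambda\in\Lambda}\{\eta_\lambda s_t^T\lambda+B_{h_\Lambda}(\lambda,\lambda_t)\},\qquad \theta_{t+1}\in\arg\min_{\theta\in\Theta}\{\eta_\theta s_t'^T\theta+B_{h_\Theta}(\theta,\theta_t)\},$$ and let $g_{t+1}=\hat g^t_{\omega_{t+1}}$ be computed from $(x_1,\mu_1),\dots,(x_t,\mu_t)$. Here $\|s_t\|\le G_\Lambda$, $\|s_t'\|\le G_\Theta$ with $G_\Lambda,G_\Theta>0$, and $\eta_\lambda=\sqrt{D_\Lambda}/(G_\Lambda\sqrt T)$, $\eta_\theta=\sqrt{D_\Theta}/(G_\Theta\sqrt T)$. The algorithm stops at the first $\tau\le T$ with $\frac1T\sum_{s\le\tau}v_s\notin\mathcal V$, and at $\tau=T$ if there is none. Let $r^\tau_{\mathrm{avg}}=\frac1T\sum_{t\le\tau}r_t^Tw_t$ and $v^\tau_{\mathrm{avg}}=\frac1T\sum_{t\le\tau}v_t$. **Theorem.**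 Let $R_{\mathrm{SPO}}(g;\omega)=\mathbb{E}[c(\mu;\omega)^T(w^*(\mu;\omega)-w^*(g(x);\omega))]$. Assume 1. $\kappa_{\mathrm{risk}},\alpha>0$ and, for all $n\ge1$, $\ \mathbb{E}\big[\sup_{\omega\in\Lambda\times\Theta}\{R_{\mathrm{SPO}}(\hat g^n_\omega;\omega)-R_{\mathrm{SPO}}(g^*;\omega)\}\big]\le\kappa_{\mathrm{risk}}\,n^{-\alpha}$; 2. $D_v\ge1$ and, for every $w\in S$, $\|V^Tw\|\le D_v$ almost surely; 3. $\zeta\ge\mathrm{OPT}/B_{\mathcal V}$ (if $B_{\mathcal V}=0$ this means $\mathrm{OPT}\le 0$). Let $\kappa_{\mathrm{MD}}=D_v(\zeta\sqrt{D_\Theta}+\sqrt{D_\Lambda})$. Then $r^\tau_{\mathrm{avg}}+u(v^\tau_{\mathrm{avg}})$ is integrable and $$\mathrm{OPT}-\mathbb{E}[r^\tau_{\mathrm{avg}}+u(v^\tau_{\mathrm{avg}})]\le\kappa_{\mathrm{MD}}\cdot C\,T^{-1/2}+\kappa_{\mathrm{risk}}\cdot C\,T^{-\alpha}\qquad(T\ge1),$$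 where $C$ depends only on $\alpha$ and on a number $c$ such that $G_\Lambda\le cD_v$, $G_\Theta\le cD_v$, $R_{\mathrm{SPO}}(g_1;\omega_1)-R_{\mathrm{SPO}}(g^*;\omega_1)\le c\,\kappa_{\mathrm{risk}}$ and, only in the case $\alpha\ge1$, $\kappa_{\mathrm{risk}}\le c\,\kappa_{\mathrm{MD}}$. -/

import Mathlib

open MeasureTheory ProbabilityTheory Set
open scoped ENNReal NNReal

noncomputable section

namespace OnlineSPO

/-! ### Convex analysis on a finite-dimensional normed space

`E` stands for `ℝ^m` with an arbitrary norm; `StrongDual ℝ E` (continuous linear functionals with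
the operator norm) is the same space with the dual norm, the pairing `yᵀ x` being `y x`. -/

section Convex

variable {E : Type*} [NormedAddCommGroup E] [NormedSpace ℝ E]

/-- The Fenchel conjugate `f*(y) = sup_x (yᵀ x - f x)` (meaningful on `conjDom f`). -/
def conj (f : E → ℝ) (y : StrongDual ℝ E) : ℝ := ⨆ x, (y x - f x)

/-- The domain of the Fenchel conjugate: the `y` at which the supremum is finite. -/
def conjDom (f : E → ℝ) : Set (StrongDual ℝ E) := {y | BddAbove (range fun x => y x - f x)}

/-- `s` is a subgradient at `y ∈ D` of the function `ξ` whose domain is `D`. -/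
def IsSubgrad (D : Set (StrongDual ℝ E)) (ξ : StrongDual ℝ E → ℝ) (y : StrongDual ℝ E)
    (s : E) : Prop :=
  y ∈ D ∧ ∀ y' ∈ D, ξ y + (y' - y) s ≤ ξ y'

/-- `h` is differentiable and `1`-strongly convex on `D`, with respect to the dual norm. -/
def IsMirrorMap (D : Set (StrongDual ℝ E)) (h : StrongDual ℝ E → ℝ) : Prop :=
  DifferentiableOn ℝ h D ∧ StrongConvexOn D 1 h

/-- The Bregman distance of `h` on `D`. The derivative is taken within `D`; for convex `D` its
values on the differences `y₁ - y₂` used here are uniquely determined. -/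
def bregman (D : Set (StrongDual ℝ E)) (h : StrongDual ℝ E → ℝ) (y₁ y₂ : StrongDual ℝ E) : ℝ :=
  h y₁ - h y₂ - fderivWithin ℝ h D y₂ (y₁ - y₂)

/-- `y' ∈ argmin_{q ∈ D} { η sᵀ q + B_h(q, y) }`: one step of online mirror descent. -/
def IsMirrorStep (D : Set (StrongDual ℝ E)) (h : StrongDual ℝ E → ℝ) (η : ℝ) (s : E)
    (y y' : StrongDual ℝ E) : Prop :=
  y' ∈ D ∧ ∀ q ∈ D, η * y' s + bregman D h y' y ≤ η * q s + bregman D h q y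

/-- The distance from `0` to the boundary of `V`, equal to `∞` if the boundary is empty. -/
def boundaryDist (V : Set E) : ℝ≥0∞ := Metric.infEDist 0 (frontier V)

open Classical in
/-- The first time `1 ≤ t ≤ T` at which `(1/T) ∑_{s ≤ t} v_s` is outside `V`; it is `T` if there is
no such time. Rounds are numbered from `0`, so `t` rounds are the indices `0, …, t - 1`. -/
def stopTime (V : Set E) (T : ℕ) (v : ℕ → E) : ℕ :=
  if h : ∃ t, 1 ≤ t ∧ t ≤ T ∧ (T : ℝ)⁻¹ • ∑ s ∈ Finset.range t, v s ∉ V then Nat.find h else T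

end Convex

/-! ### The decision problem -/

/-- A pair `(r, V)`: reward vector `r ∈ ℝ^d` and consumption matrix `V ∈ ℝ^{d × m}`, the latter
given as the linear map `w ↦ Vᵀ w`. -/
abbrev Outcome (W E : Type*) [NormedAddCommGroup W] [NormedSpace ℝ W]
    [NormedAddCommGroup E] [NormedSpace ℝ E] : Type _ :=
  StrongDual ℝ W × (W →L[ℝ] E)

/-- A pair `ω = (λ, θ)` of dual variables. -/
abbrev Duals (E : Type*) [NormedAddCommGroup E] [NormedSpace ℝ E] : Type _ :=
  StrongDual ℝ E × StrongDual ℝ E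

/-- The cost vector `r - V λ - ζ V θ`. -/
def cost {W E : Type*} [NormedAddCommGroup W] [NormedSpace ℝ W]
    [NormedAddCommGroup E] [NormedSpace ℝ E]
    (ζ : ℝ) (μ : Outcome W E) (ω : Duals E) : StrongDual ℝ W :=
  μ.1 - ω.1.comp μ.2 - ζ • ω.2.comp μ.2

/-- The data of the problem with the standing assumptions. `X` is the space of features, `W` is
`ℝ^d` (decisions) and `E` is `ℝ^m` (consumption vectors), each with an arbitrary norm. -/
structure Problem (X W E : Type*) [MeasurableSpace X]
    [NormedAddCommGroup W] [NormedSpace ℝ W] [MeasurableSpace W]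
    [NormedAddCommGroup E] [NormedSpace ℝ E] where
  /-- feasible decisions -/
  S : Set W
  /-- feasible consumption vectors -/
  V : Set E
  /-- utility of consumption -/
  u : E → ℝ
  /-- Lipschitz constant of the utility -/
  L : ℝ≥0
  /-- distribution of `(x, (r, V))` -/
  P : Measure (X × Outcome W E)
  convex_S : Convex ℝ S
  compact_S : IsCompact S
  convex_V : Convex ℝ V
  closed_V : IsClosed V
  zero_mem_V : (0 : E) ∈ V
  lipschitz_u : LipschitzWith L u
  concave_u : ConcaveOn ℝ univ u
  u_zero : u 0 = 0
  prob : IsProbabilityMeasure P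
  integrable_outcome : Integrable (fun z : X × Outcome W E => z.2) P

attribute [instance] Problem.prob

section

variable {X W E : Type*} [MeasurableSpace X]
  [NormedAddCommGroup W] [NormedSpace ℝ W] [MeasurableSpace W]
  [NormedAddCommGroup E] [NormedSpace ℝ E]

namespace Problem

variable (p : Problem X W E)

/-- The function `-u`. -/
def negU (v : E) : ℝ := -p.u v

/-- The distance function `d_V` of the set of feasible consumption vectors. -/
def distV (v : E) : ℝ := Metric.infDist v p.V

/-- `Λ`, the domain of `(-u)*`. -/
def LamDom : Set (StrongDual ℝ E) := conjDom p.negU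

/-- `Θ`, the domain of `d_V*`. -/
def ThDom : Set (StrongDual ℝ E) := conjDom p.distV

/-- `ξ(λ) = -vᵀ λ + (-u)*(λ)`. -/
def xi (v : E) (lam : StrongDual ℝ E) : ℝ := -lam v + conj p.negU lam

/-- `φ(θ) = -vᵀ θ + d_V*(θ)`. -/
def phi (v : E) (th : StrongDual ℝ E) : ℝ := -th v + conj p.distV th

/-- Expected reward of a static policy. -/
def rew (π : X → W) : ℝ := ∫ z, z.2.1 (π z.1) ∂p.P

/-- Expected consumption of a static policy. -/
def con (π : X → W) : E := ∫ z, z.2.2 (π z.1) ∂p.P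

/-- Static policies `π : X → S` with `con π ∈ V`. -/
def IsFeasiblePolicy (π : X → W) : Prop := Measurable π ∧ (∀ x, π x ∈ p.S) ∧ p.con π ∈ p.V

/-- The optimal static value. -/
def OPT : ℝ := sSup {a | ∃ π, p.IsFeasiblePolicy π ∧ a = p.rew π + p.u (p.con π)}

/-- `‖Vᵀ w‖ ≤ D_v` almost surely, for every `w ∈ S`. -/
def BoundedConsumption (Dv : ℝ) : Prop := ∀ w ∈ p.S, ∀ᵐ z ∂p.P, ‖z.2.2 w‖ ≤ Dv

/-- `gstar` is a version of the conditional expectation `x ↦ E[(r, V) | x]`. -/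
def IsBayes (gstar : X → Outcome W E) : Prop :=
  Measurable gstar ∧
    (fun z : X × Outcome W E => gstar z.1) =ᵐ[p.P]
      (p.P)[fun z : X × Outcome W E => z.2 | MeasurableSpace.comap Prod.fst inferInstance]

end Problem

/-! ### The algorithm -/

/-- The ingredients of the algorithm with penalty parameter `ζ`: the linear optimization oracle
over `S`, the hypothesis class with a surrogate loss and an empirical risk minimizer, the mirror
maps, and the initial values of the dual variables and of the prediction model. -/
structure Method (p : Problem X W E) (ζ : ℝ) where
  /-- the oracle `w*(μ; ω)` -/
  wstar : Outcome W E → Duals E → W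
  wstar_mem : ∀ μ, ∀ ω ∈ p.LamDom ×ˢ p.ThDom, wstar μ ω ∈ p.S
  wstar_max : ∀ μ, ∀ ω ∈ p.LamDom ×ˢ p.ThDom, ∀ w ∈ p.S, cost ζ μ ω w ≤ cost ζ μ ω (wstar μ ω)
  wstar_meas : Measurable fun q : Outcome W E × Duals E => wstar q.1 q.2
  /-- the hypothesis class -/
  H : Set (X → Outcome W E)
  /-- the surrogate loss `ℓ(ĉ, c)` of a predicted and a realized cost vector -/
  loss : StrongDual ℝ W → StrongDual ℝ W → ℝ
  /-- the empirical risk minimizer, given `n` samples and dual variables `ω` -/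
  erm : (n : ℕ) → (Fin n → X × Outcome W E) → Duals E → X → Outcome W E
  erm_mem : ∀ n, 0 < n → ∀ D, ∀ ω ∈ p.LamDom ×ˢ p.ThDom, erm n D ω ∈ H
  erm_min : ∀ n, 0 < n → ∀ D, ∀ ω ∈ p.LamDom ×ˢ p.ThDom, ∀ g ∈ H,
    ∑ i, loss (cost ζ (erm n D ω (D i).1) ω) (cost ζ (D i).2 ω) ≤
      ∑ i, loss (cost ζ (g (D i).1) ω) (cost ζ (D i).2 ω)
  erm_meas : ∀ n, 0 < n → Measurable
    fun q : (Fin n → X × Outcome W E) × Duals E × X => erm n q.1 q.2.1 q.2.2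
  /-- mirror map on `Λ` -/
  hLam : StrongDual ℝ E → ℝ
  /-- mirror map on `Θ` -/
  hTh : StrongDual ℝ E → ℝ
  mirror_Lam : IsMirrorMap p.LamDom hLam
  mirror_Th : IsMirrorMap p.ThDom hTh
  /-- initial dual variables `(λ_1, θ_1)` -/
  init : Duals E
  init_mem : init ∈ p.LamDom ×ˢ p.ThDom
  /-- initial prediction model -/
  g₁ : X → Outcome W E
  g₁_meas : Measurable g₁

namespace Method

variable {p : Problem X W E} {ζ : ℝ} (M : Method p ζ)

/-- The SPO loss `(r - V λ - ζ V θ)ᵀ (w*(μ; ω) - w*(μ̂; ω))`. -/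
def spoLoss (μhat μ : Outcome W E) (ω : Duals E) : ℝ :=
  cost ζ μ ω (M.wstar μ ω - M.wstar μhat ω)

/-- The SPO risk `R_SPO(g; ω)`. -/
def spoRisk (g : X → Outcome W E) (ω : Duals E) : ℝ := ∫ z, M.spoLoss (g z.1) z.2 ω ∂p.P

/-- The uniform excess SPO risk bound: for all `n ≥ 1`,
`E [sup_ω { R_SPO(ĝⁿ; ω) - R_SPO(g*; ω) }] ≤ κ n^{-α}`. The excess risks are nonnegative, so the
supremum and the expectation are taken in `[0, ∞]`. -/
def ExcessRiskBound (gstar : X → Outcome W E) (κ α : ℝ) : Prop :=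
  ∀ n : ℕ, 0 < n →
    ∫⁻ D, (⨆ ω ∈ p.LamDom ×ˢ p.ThDom,
        ENNReal.ofReal (M.spoRisk (M.erm n D ω) ω - M.spoRisk gstar ω))
      ∂(Measure.pi fun _ : Fin n => p.P) ≤ ENNReal.ofReal (κ * (n : ℝ) ^ (-α))

section Paths

variable {Ω : Type*} (z : ℕ → Ω → X × Outcome W E) (lam th : ℕ → Ω → StrongDual ℝ E)

/-- The prediction model of round `t`. Rounds are numbered from `0`, so that round `t` is preceded
by `t` samples. -/
def model (t : ℕ) (o : Ω) : X → Outcome W E :=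
  if t = 0 then M.g₁ else M.erm t (fun i => z i o) (lam t o, th t o)

/-- The decision `w_t`. -/
def decision (t : ℕ) (o : Ω) : W :=
  M.wstar (M.model z lam th t o (z t o).1) (lam t o, th t o)

/-- The consumption `v_t = V_tᵀ w_t`. -/
def consumption (t : ℕ) (o : Ω) : E := (z t o).2.2 (M.decision z lam th t o)

/-- The stopping time `τ`, which is the number of rounds that are played. -/
def tau (T : ℕ) (o : Ω) : ℕ := stopTime p.V T fun t => M.consumption z lam th t o

/-- `r_avg^τ = (1/T) ∑_{t ≤ τ} r_tᵀ w_t`. -/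
def rAvg (T : ℕ) (o : Ω) : ℝ :=
  (T : ℝ)⁻¹ * ∑ t ∈ Finset.range (M.tau z lam th T o), (z t o).2.1 (M.decision z lam th t o)

/-- `v_avg^τ = (1/T) ∑_{t ≤ τ} v_t`. -/
def vAvg (T : ℕ) (o : Ω) : E :=
  (T : ℝ)⁻¹ • ∑ t ∈ Finset.range (M.tau z lam th T o), M.consumption z lam th t o

end Paths

/-- A run of the algorithm over horizon `T` with step sizes `ηLam`, `ηTh`, stopped at `τ`. The dual
variables of round `t` are functions of the first `t` samples, and each round that is played ends
with a mirror descent step along arbitrary subgradients of `ξ_t` and `φ_t`. -/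
structure Run (T : ℕ) (ηLam ηTh : ℝ) {Ω : Type*} [MeasurableSpace Ω] (Pr : Measure Ω) where
  /-- the samples `(x_t, (r_t, V_t))` -/
  z : ℕ → Ω → X × Outcome W E
  z_meas : ∀ t, Measurable (z t)
  z_law : ∀ t, Pr.map (z t) = p.P
  z_indep : iIndepFun z Pr
  /-- the dual variables `λ_t` -/
  lam : ℕ → Ω → StrongDual ℝ E
  /-- the dual variables `θ_t` -/
  th : ℕ → Ω → StrongDual ℝ E
  lam_zero : ∀ o, lam 0 o = M.init.1
  th_zero : ∀ o, th 0 o = M.init.2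
  lam_adapted : ∀ t, Measurable[⨆ i : Fin t, MeasurableSpace.comap (z i) inferInstance] (lam t)
  th_adapted : ∀ t, Measurable[⨆ i : Fin t, MeasurableSpace.comap (z i) inferInstance] (th t)
  /-- the subgradient of `ξ_t` at `λ_t` -/
  subLam : ℕ → Ω → E
  /-- the subgradient of `φ_t` at `θ_t` -/
  subTh : ℕ → Ω → E
  subLam_mem : ∀ᵐ o ∂Pr, ∀ t < M.tau z lam th T o,
    IsSubgrad p.LamDom (p.xi (M.consumption z lam th t o)) (lam t o) (subLam t o)
  subTh_mem : ∀ᵐ o ∂Pr, ∀ t < M.tau z lam th T o,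
    IsSubgrad p.ThDom (p.phi (M.consumption z lam th t o)) (th t o) (subTh t o)
  lam_step : ∀ᵐ o ∂Pr, ∀ t < M.tau z lam th T o,
    IsMirrorStep p.LamDom M.hLam ηLam (subLam t o) (lam t o) (lam (t + 1) o)
  th_step : ∀ᵐ o ∂Pr, ∀ t < M.tau z lam th T o,
    IsMirrorStep p.ThDom M.hTh ηTh (subTh t o) (th t o) (th (t + 1) o)

namespace Run

variable {M} {T : ℕ} {ηLam ηTh : ℝ} {Ω : Type*} [MeasurableSpace Ω] {Pr : Measure Ω}
  (R : M.Run T ηLam ηTh Pr)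

/-- The number `τ` of rounds played in the run. -/
def tau (o : Ω) : ℕ := M.tau R.z R.lam R.th T o

/-- `r_avg^τ + u(v_avg^τ)`. -/
def value (o : Ω) : ℝ := M.rAvg R.z R.lam R.th T o + p.u (M.vAvg R.z R.lam R.th T o)

end Run

end Method

end

/-- `κ_MD = D_v (ζ √D_Θ + √D_Λ)`. -/
def kappaMD (Dv ζ DLam DTh : ℝ) : ℝ := Dv * (ζ * √DTh + √DLam)

end OnlineSPO

end

/-! The argument is Lagrangian: weak duality bounds OPT in every round, and mirror descent regret
and prediction error account for the gap. By Fenchel's inequality, every ω = (λ, θ) in the domains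
gives an upper bound on OPT, namely the best expected cost under ω plus (-u)*(λ) + ζ d_V*(θ)
(`Method.OPT_le`). The Bayes predictor attains that best cost, because the cost is linear in the
outcome and a policy sees only the feature. Whether round t is played, ω_t and the model are
determined by the earlier samples, so the conditional expected cost of w_t falls short of the best
one exactly by the excess SPO risk (`integral_indicator_cost`, `spoRisk_sub`).

Summing over the τ played rounds leaves ∑ [(-u)*(λ_t) - λ_t v_t] and ζ ∑ [d_V*(θ_t) - θ_t v_t],
which mirror descent compares with fixed dual vectors (`mirrorDescent_regret`). For λ, a vector with
equality in Fenchel's inequality at v_avg produces T u(v_avg). For θ, the zero vector serves when τ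
= T. When τ < T, v_avg is outside V, and a separating θ of norm one satisfies ζ d_V*(θ) ≥ OPT by the
choice of ζ; the violation thus pays for the T - τ missing rounds (`exists_separating`,
`mul_OPT_le_of_path`).

Taking expectations gives `mul_OPT_sub_le`. The excess risks then sum to order T^(1-α) if α < 1; if
α ≥ 1 the sum is dominated by ∑ t^(-1/2) and charged to κ_MD. -/

open Filter Topology

namespace OnlineSPO

/-! ### Fenchel conjugates and separation from `V` -/

section ConvexAnalysis

variable {E : Type*} [NormedAddCommGroup E] [NormedSpace ℝ E]

lemma le_conj {f : E → ℝ} {y : StrongDual ℝ E} (hy : y ∈ conjDom f) (x : E) :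
    y x - f x ≤ conj f y := le_ciSup hy x

lemma conj_le {f : E → ℝ} {y : StrongDual ℝ E} {c : ℝ} (h : ∀ x, y x - f x ≤ c) :
    conj f y ≤ c := ciSup_le h

lemma mem_conjDom_of_le {f : E → ℝ} {y : StrongDual ℝ E} {c : ℝ} (h : ∀ x, y x - f x ≤ c) :
    y ∈ conjDom f := ⟨c, by rintro _ ⟨x, rfl⟩; exact h x⟩

lemma convex_conjDom (f : E → ℝ) : Convex ℝ (conjDom f) := by
  intro y hy y' hy' a b ha hb hab
  refine mem_conjDom_of_le (c := a * conj f y + b * conj f y') fun x => ?_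
  have h1 := mul_le_mul_of_nonneg_left (le_conj hy x) ha
  have h2 := mul_le_mul_of_nonneg_left (le_conj hy' x) hb
  have h3 : f x = a * f x + b * f x := by rw [← add_mul, hab, one_mul]
  simp only [add_apply, smul_apply, smul_eq_mul]
  linarith

/-- If `y x` exceeded `L * ‖x‖`, then `y - f` would be unbounded along the ray through `x`. Hence Λ
and Θ are bounded, which makes all costs integrable. -/
lemma norm_le_of_mem_conjDom {f : E → ℝ} {L : ℝ≥0} (hf : LipschitzWith L f)
    {y : StrongDual ℝ E} (hy : y ∈ conjDom f) : ‖y‖ ≤ L := by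
  have key : ∀ x, y x ≤ L * ‖x‖ := by
    intro x
    by_contra! hlt
    obtain ⟨n, hn⟩ := exists_nat_gt ((conj f y + f 0) / (y x - L * ‖x‖))
    rw [div_lt_iff₀ (by linarith)] at hn
    have h1 := le_conj hy ((n : ℝ) • x)
    have h2 := hf.dist_le_mul ((n : ℝ) • x) 0
    rw [dist_zero_right, norm_smul, Real.norm_natCast, Real.dist_eq] at h2
    have h3 := (abs_le.1 h2).2
    simp only [map_smul, smul_eq_mul] at h1
    nlinarith
  refine ContinuousLinearMap.opNorm_le_bound _ L.2 fun x => ?_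
  rw [Real.norm_eq_abs, abs_le]
  have := key (-x)
  rw [map_neg, norm_neg] at this
  exact ⟨by linarith, key x⟩

/-- A subgradient of `f` at `v` does it. It comes from separating `(v, f v)` from the open strict
epigraph and normalizing the vertical component of the functional, which is negative, to `-1`. -/
lemma exists_conj_eq {f : E → ℝ} (hf : ConvexOn ℝ univ f) (hc : Continuous f) (v : E) :
    ∃ y ∈ conjDom f, conj f y = y v - f v := by
  have hs : Convex ℝ {q : E × ℝ | q.1 ∈ (univ : Set E) ∧ f q.1 < q.2} := hf.convex_strict_epigraph
  have ho : IsOpen {q : E × ℝ | q.1 ∈ (univ : Set E) ∧ f q.1 < q.2} := by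
    simpa using isOpen_lt (hc.comp continuous_fst) continuous_snd
  obtain ⟨F, hF⟩ := geometric_hahn_banach_open_point (x := (v, f v)) hs ho (by simp)
  have hsplit : ∀ x r, F (x, r) = F (x, 0) + r * F (0, 1) := by
    intro x r
    have : (x, r) = (x, (0 : ℝ)) + r • ((0 : E), (1 : ℝ)) := by simp
    rw [this, map_add, map_smul, smul_eq_mul]
  have ha : F (0, 1) < 0 := by
    have := hF (v, f v + 1) (by simp)
    rw [hsplit v (f v + 1), hsplit v (f v)] at this
    linarith
  have hle : ∀ x, F (x, 0) + f x * F (0, 1) ≤ F (v, 0) + f v * F (0, 1) := by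
    intro x
    refine le_of_forall_pos_le_add fun ε hε => ?_
    -- The point is lifted into the strict epigraph by the height that costs exactly `ε` under `F`.
    have h1 : 0 < ε / -F (0, 1) := div_pos hε (by linarith)
    have := hF (x, f x + ε / -F (0, 1)) (by simpa using h1)
    rw [hsplit x, hsplit v (f v)] at this
    have h2 : ε / -F (0, 1) * F (0, 1) = -ε := by
      rw [div_neg, neg_mul, div_mul_cancel₀ _ ha.ne]
    linarith
  have hy : ∀ x, ((-F (0, 1))⁻¹ • F.comp (ContinuousLinearMap.inl ℝ E ℝ)) x - f x ≤
      ((-F (0, 1))⁻¹ • F.comp (ContinuousLinearMap.inl ℝ E ℝ)) v - f v := by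
    intro x
    have h3 := hle x
    simp only [smul_apply, ContinuousLinearMap.comp_apply,
      ContinuousLinearMap.inl_apply, smul_eq_mul]
    have h4 : 0 < (-F (0, 1))⁻¹ := inv_pos.2 (by linarith)
    have h5 := mul_le_mul_of_nonneg_left h3 h4.le
    have h6 : (-F (0, 1))⁻¹ * F (0, 1) = -1 := by
      rw [inv_neg, neg_mul, inv_mul_cancel₀ ha.ne]
    have h7 : ∀ r, (-F (0, 1))⁻¹ * (r * F (0, 1)) = -r := by
      intro r
      rw [mul_left_comm, h6]; ring
    rw [mul_add, mul_add, h7, h7] at h5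
    linarith
  refine ⟨_, mem_conjDom_of_le hy, le_antisymm (conj_le hy) (le_conj (mem_conjDom_of_le hy) v)⟩

lemma conj_nonneg {f : E → ℝ} (h0 : f 0 = 0) {y : StrongDual ℝ E} (hy : y ∈ conjDom f) :
    0 ≤ conj f y := by
  simpa [h0] using le_conj hy 0

/-- The segment from `0` to `b` is connected, so leaving `V` would force it through the frontier, at
a point of norm at most `‖b‖`. -/
lemma mem_of_enorm_lt_boundaryDist {V : Set E} (hc : IsClosed V) (h0 : (0 : E) ∈ V)
    {b : E}
    (hb : ‖b‖ₑ < boundaryDist V) : b ∈ V := by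
  by_contra hbV
  obtain ⟨x, hxs, hx⟩ : ∃ x ∈ segment ℝ 0 b, x ∈ frontier V := by
    by_contra! hx
    have hin : ∀ x ∈ segment ℝ 0 b, x ∈ V → x ∈ interior V := fun x hxs hxV => by
      by_contra hxi
      exact hx x hxs ⟨subset_closure hxV, hxi⟩
    have := (convex_segment (𝕜 := ℝ) (0 : E) b).isPreconnected.subset_left_of_subset_union
      isOpen_interior hc.isOpen_compl (disjoint_compl_right.mono_left interior_subset)
      (fun x hxs => (em (x ∈ V)).imp (hin x hxs) id)
      ⟨0, left_mem_segment _ _ _, hin 0 (left_mem_segment _ _ _) h0⟩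
    exact hbV (interior_subset (this (right_mem_segment _ _ _)))
  have h1 : boundaryDist V ≤ edist 0 x := Metric.infEDist_le_edist_of_mem hx
  have h2 : ‖x‖ ≤ ‖b‖ := by
    obtain ⟨a, c, ha, hc, hac, rfl⟩ := hxs
    simp only [smul_zero, zero_add, norm_smul, Real.norm_eq_abs, abs_of_nonneg hc]
    nlinarith [norm_nonneg b]
  have h3 : ‖x‖ₑ ≤ ‖b‖ₑ := by
    rw [← ofReal_norm, ← ofReal_norm]; exact ENNReal.ofReal_le_ofReal h2
  rw [edist_comm, edist_zero_right] at h1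
  exact absurd (h1.trans h3) (not_le.2 hb)

/-- A point outside `V` is separated from `V` by a functional of norm `1`, whose support function
is at least the distance from `0` to the boundary of `V`. -/
lemma exists_separating {V : Set E} (hV : Convex ℝ V) (hc : IsClosed V) (h0 : (0 : E) ∈ V)
    {v : E} (hv : v ∉ V) {a ζ : ℝ} (hζ : 0 < ζ)
    (h : ENNReal.ofReal a / boundaryDist V ≤ ENNReal.ofReal ζ) :
    ∃ θ ∈ conjDom (fun x => Metric.infDist x V),
      conj (fun x => Metric.infDist x V) θ ≤ θ v ∧
      a ≤ ζ * conj (fun x => Metric.infDist x V) θ := by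
  obtain ⟨F, r, hF, hr⟩ := geometric_hahn_banach_closed_point hV hc hv
  have hr0 : 0 < r := by simpa using hF 0 h0
  have hFn : 0 < ‖F‖ := by
    refine norm_pos_iff.2 fun hF0 => ?_
    simp [hF0] at hr; linarith
  set θ : StrongDual ℝ E := ‖F‖⁻¹ • F with hθ
  have hθn : ‖θ‖ = 1 := by
    rw [hθ, norm_smul, norm_inv, norm_norm, inv_mul_cancel₀ hFn.ne']
  have hθV : ∀ x ∈ V, θ x ≤ θ v := fun x hx => by
    simp only [hθ, smul_apply, smul_eq_mul]
    exact mul_le_mul_of_nonneg_left ((hF x hx).trans hr).le (inv_nonneg.2 hFn.le)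
  -- Norm one makes `θ` 1-Lipschitz, so its excess over its bound on `V` is at most the distance to
  -- `V`.
  have hle : ∀ x, θ x - Metric.infDist x V ≤ θ v := by
    intro x
    have : θ x - θ v ≤ Metric.infDist x V := by
      refine (Metric.le_infDist ⟨0, h0⟩).2 fun y hy => ?_
      have h1 := hθV y hy
      have h2 : θ (x - y) ≤ dist x y := by
        rw [dist_eq_norm]
        exact (le_abs_self _).trans ((θ.le_opNorm _).trans (by rw [hθn, one_mul]))
      rw [map_sub] at h2
      linarith
    linarith
  have hmem := mem_conjDom_of_le hle
  refine ⟨θ, hmem, conj_le hle, ?_⟩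
  set k := conj (fun x => Metric.infDist x V) θ
  have hk0 : 0 ≤ k := conj_nonneg (by simp [Metric.infDist_zero_of_mem h0]) hmem
  have hkV : ∀ b ∈ V, θ b ≤ k := fun b hb => by
    simpa [Metric.infDist_zero_of_mem hb] using le_conj hmem b
  rcases le_or_gt a 0 with ha | ha
  · exact ha.trans (mul_nonneg hζ.le hk0)
  have hBt : boundaryDist V ≠ ⊤ := by
    intro hB
    exact hv (mem_of_enorm_lt_boundaryDist hc h0 (hB ▸ enorm_lt_top))
  -- In `ℝ≥0∞` a positive number divided by `0` is `⊤`, so the hypothesis excludes this case once `0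
  -- < a`.
  have hB0 : boundaryDist V ≠ 0 := by
    intro hB
    rw [hB, ENNReal.div_zero (by simpa using ha)] at h
    simp at h
  have haB : a ≤ ζ * (boundaryDist V).toReal := by
    rw [ENNReal.div_le_iff hB0 hBt] at h
    have := ENNReal.toReal_mono (ENNReal.mul_ne_top ENNReal.ofReal_ne_top hBt) h
    rwa [ENNReal.toReal_ofReal ha.le, ENNReal.toReal_mul, ENNReal.toReal_ofReal hζ.le] at this
  refine haB.trans (mul_le_mul_of_nonneg_left ?_ hζ.le)
  refine le_of_forall_lt fun r hrB => ?_
  -- Vectors of norm `r'` lie in `V`, where `θ ≤ k`; hence `r' * ‖θ‖ ≤ k`. The maximum with `0`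
  -- keeps `r'` positive for the division.
  obtain ⟨r', hr1, hr2⟩ := exists_between (max_lt hrB (ENNReal.toReal_pos hB0 hBt))
  refine ((le_max_left _ _).trans_lt hr1).trans_le ?_
  have hr'0 : 0 < r' := (le_max_right _ _).trans_lt hr1
  have hball : ∀ x : E, r' * θ x ≤ k * ‖x‖ := by
    intro x
    rcases eq_or_ne x 0 with rfl | hx
    · simp
    have hxn := norm_pos_iff.2 hx
    have hb : (r' / ‖x‖) • x ∈ V := by
      refine mem_of_enorm_lt_boundaryDist hc h0 ?_
      rw [← ofReal_norm, norm_smul, Real.norm_of_nonneg (by positivity), div_mul_cancel₀ _ hxn.ne',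
        ENNReal.ofReal_lt_iff_lt_toReal hr'0.le hBt]
      exact hr2
    have := hkV _ hb
    rw [map_smul, smul_eq_mul, div_mul_eq_mul_div, div_le_iff₀ hxn] at this
    exact this
  have : ‖θ‖ ≤ k / r' := by
    refine ContinuousLinearMap.opNorm_le_bound _ (by positivity) fun x => ?_
    have h1 := hball x
    have h2 := hball (-x)
    rw [map_neg, norm_neg] at h2
    rw [div_mul_eq_mul_div, le_div_iff₀ hr'0, mul_comm, Real.norm_eq_abs]
    rcases abs_cases (θ x) with ⟨h3, -⟩ | ⟨h3, -⟩ <;> rw [h3] <;> assumption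
  rw [hθn, le_div_iff₀ hr'0, one_mul] at this
  exact this

end ConvexAnalysis

/-! ### Online mirror descent -/

section MirrorDescent

variable {E : Type*} [NormedAddCommGroup E] [NormedSpace ℝ E]
  {D : Set (StrongDual ℝ E)} {h : StrongDual ℝ E → ℝ}

/-- `D` may have empty interior, so the derivative within `D` need not be unique. Towards points of
`D` it is a one-sided directional derivative, and only these values enter below. -/
lemma tendsto_directional_slope (hD : Convex ℝ D) (hd : DifferentiableOn ℝ h D)
    {x y : StrongDual ℝ E} (hx : x ∈ D) (hy : y ∈ D) :
    Tendsto (fun ε : ℝ => ε⁻¹ * (h (y + ε • (x - y)) - h y)) (𝓝[>] 0)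
      (𝓝 (fderivWithin ℝ h D y (x - y))) := by
  have hl : HasDerivWithinAt (fun ε : ℝ => y + ε • (x - y)) (x - y) (Icc 0 1) 0 := by
    simpa using ((hasDerivWithinAt_id (0 : ℝ) (Icc 0 1)).smul_const (x - y)).const_add y
  have hm : MapsTo (fun ε : ℝ => y + ε • (x - y)) (Icc 0 1) D := fun ε hε =>
    hD.add_smul_sub_mem hy hx hε
  have hf : HasFDerivWithinAt h (fderivWithin ℝ h D y) D ((fun ε : ℝ => y + ε • (x - y)) 0) := by
    simpa using (hd y hy).hasFDerivWithinAt
  have := hf.comp_hasDerivWithinAt (0 : ℝ) hl hm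
  rw [hasDerivWithinAt_iff_tendsto_slope, Icc_sdiff_left, nhdsWithin_Ioc_eq_nhdsGT one_pos] at this
  refine this.congr fun ε => ?_
  simp [slope_def_module]

lemma eventually_mem_Ioc : ∀ᶠ ε : ℝ in 𝓝[>] 0, ε ∈ Ioc (0 : ℝ) 1 :=
  Ioc_mem_nhdsGT one_pos

/-- Strong convexity at `ε • x + (1 - ε) • y`, divided by `ε`, as `ε → 0`. -/
lemma half_norm_sq_le_bregman (hD : Convex ℝ D) (hh : IsMirrorMap D h)
    {x y : StrongDual ℝ E} (hx : x ∈ D) (hy : y ∈ D) :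
    1 / 2 * ‖x - y‖ ^ 2 ≤ bregman D h x y := by
  have h1 := tendsto_directional_slope hD hh.1 hx hy
  have h2 : Tendsto (fun ε : ℝ => h x - h y - (1 - ε) * (1 / 2 * ‖x - y‖ ^ 2)) (𝓝[>] 0)
      (𝓝 (h x - h y - (1 - 0) * (1 / 2 * ‖x - y‖ ^ 2))) :=
    (Continuous.tendsto (by fun_prop) 0).mono_left nhdsWithin_le_nhds
  have h3 := le_of_tendsto_of_tendsto h1 h2 (by
    filter_upwards [eventually_mem_Ioc] with ε hε
    have h4 := hh.2.2 hx hy hε.1.le (sub_nonneg.2 hε.2) (by ring)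
    have h5 : ε • x + (1 - ε) • y = y + ε • (x - y) := by
      module
    rw [h5] at h4
    rw [inv_mul_le_iff₀ hε.1]
    simp only [smul_eq_mul] at h4
    nlinarith)
  unfold bregman
  linarith

/-- First-order condition for the minimizer `y'`, obtained by moving from it a fraction `ε` towards
`q`. -/
lemma mirrorStep_optimality (hD : Convex ℝ D) (hh : IsMirrorMap D h) {η : ℝ} {s : E}
    {y y' q : StrongDual ℝ E} (hs : IsMirrorStep D h η s y y') (hq : q ∈ D) :
    fderivWithin ℝ h D y (q - y') - η * (q - y') s ≤ fderivWithin ℝ h D y' (q - y') := by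
  refine ge_of_tendsto (tendsto_directional_slope hD hh.1 hq hs.1) ?_
  filter_upwards [eventually_mem_Ioc] with ε hε
  have h1 := hs.2 _ (hD.add_smul_sub_mem hs.1 hq ⟨hε.1.le, hε.2⟩)
  unfold bregman at h1
  rw [le_inv_mul_iff₀ hε.1]
  have h2 : y' + ε • (q - y') - y = (y' - y) + ε • (q - y') := by abel
  rw [h2, map_add, map_smul] at h1
  simp only [add_apply, smul_apply, smul_eq_mul] at h1
  nlinarith

/-- The three-point identity for Bregman distances turns optimality into a telescoping difference
minus `bregman D h y' y`. That term absorbs the quadratic part when Young's inequality is applied to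
`η * (y - y') s`. -/
lemma mirrorStep_regret (hD : Convex ℝ D) (hh : IsMirrorMap D h) {η G : ℝ} (hη : 0 ≤ η) {s : E}
    (hG : ‖s‖ ≤ G) {y y' q : StrongDual ℝ E} (hs : IsMirrorStep D h η s y y') (hy : y ∈ D)
    (hq : q ∈ D) :
    η * (y - q) s ≤ bregman D h q y - bregman D h q y' + 1 / 2 * (η * G) ^ 2 := by
  have h1 := mirrorStep_optimality hD hh hs hq
  have h2 := half_norm_sq_le_bregman hD hh hs.1 hy
  have h3 : η * (y - y') s ≤ 1 / 2 * (η * G) ^ 2 + 1 / 2 * ‖y' - y‖ ^ 2 := by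
    have h4 : (y - y') s ≤ ‖y' - y‖ * G := by
      refine (le_abs_self _).trans (((y - y').le_opNorm s).trans ?_)
      rw [norm_sub_rev]
      exact mul_le_mul_of_nonneg_left hG (norm_nonneg _)
    have h5 := mul_le_mul_of_nonneg_left h4 hη
    nlinarith [sq_nonneg (η * G - ‖y' - y‖)]
  have h6 : q - y = (q - y') + (y' - y) := by abel
  unfold bregman at *
  rw [h6, map_add]
  simp only [sub_apply] at *
  nlinarith

lemma bregman_self (y : StrongDual ℝ E) : bregman D h y y = 0 := by simp [bregman]

/-- The regret bound of online mirror descent run for `n ≤ T` steps with a constant step size. -/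
lemma mirrorDescent_regret (hD : Convex ℝ D) (hh : IsMirrorMap D h) {B G : ℝ} (hG : 0 < G)
    (hB : ∀ y₁ ∈ D, ∀ y₂ ∈ D, bregman D h y₁ y₂ ≤ B) {T n : ℕ} (hT : 0 < T) (hn : n ≤ T)
    {y : ℕ → StrongDual ℝ E} {s : ℕ → E} (hy : ∀ t < n, y t ∈ D) (hs : ∀ t < n, ‖s t‖ ≤ G)
    (hstep : ∀ t < n, IsMirrorStep D h (√B / (G * √T)) (s t) (y t) (y (t + 1)))
    {q : StrongDual ℝ E} (hq : q ∈ D) :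
    ∑ t ∈ Finset.range n, (y t - q) (s t) ≤ 3 / 2 * (G * √B * √T) := by
  have hB0 : 0 ≤ B := bregman_self (D := D) (h := h) q ▸ hB q hq q hq
  have hTr : (0 : ℝ) < T := Nat.cast_pos.2 hT
  -- For `B = 0` the step size vanishes and cannot be divided by; strong convexity then reduces `D`
  -- to a point.
  rcases hB0.eq_or_lt with hB0 | hB0
  · rw [Finset.sum_eq_zero]
    · positivity
    intro t ht
    have h1 := (half_norm_sq_le_bregman hD hh (hy t (Finset.mem_range.1 ht)) hq).trans
      (hB _ (hy t (Finset.mem_range.1 ht)) _ hq)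
    have h2 : ‖y t - q‖ = 0 := by
      have : ‖y t - q‖ ^ 2 = 0 := le_antisymm (by linarith) (sq_nonneg _)
      simpa using this
    rw [norm_eq_zero.1 h2]; simp
  set η := √B / (G * √T) with hη
  have hη0 : 0 < η := by positivity
  have hηG : (η * G) ^ 2 * T = B := by
    rw [hη]; field_simp; rw [Real.sq_sqrt hB0.le, Real.sq_sqrt hTr.le]; ring
  have hsum : ∀ k ≤ n, η * ∑ t ∈ Finset.range k, (y t - q) (s t) ≤
      bregman D h q (y 0) - bregman D h q (y k) + k * (1 / 2 * (η * G) ^ 2) := by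
    intro k hk
    induction k with
    | zero => simp
    | succ k ih =>
      rw [Finset.sum_range_succ, mul_add]
      have := mirrorStep_regret hD hh hη0.le (hs k hk) (hstep k hk) (hy k hk) hq
      have := ih (by omega)
      rw [Nat.cast_succ]
      linarith
  have h3 := hsum n le_rfl
  have h4 : bregman D h q (y 0) - bregman D h q (y n) ≤ B := by
    rcases Nat.eq_zero_or_pos n with rfl | hn0
    · simpa using hB0.le
    have hyn : y n ∈ D := by
      obtain ⟨k, rfl⟩ := Nat.exists_eq_succ_of_ne_zero hn0.ne'
      exact (hstep k (by omega)).1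
    have h5 := half_norm_sq_le_bregman hD hh hq hyn
    have h6 := hB q hq (y 0) (hy 0 hn0)
    nlinarith [sq_nonneg ‖q - y n‖]
  have h5 : (n : ℝ) * (1 / 2 * (η * G) ^ 2) ≤ 1 / 2 * B := by
    have : (n : ℝ) ≤ T := Nat.cast_le.2 hn
    nlinarith [sq_nonneg (η * G)]
  -- After multiplication by `η`, the telescoped distances contribute `B` and the quadratic terms at
  -- most `B / 2`.
  have h6 : η * (3 / 2 * (G * √B * √T)) = 3 / 2 * B := by
    rw [hη]; field_simp; rw [Real.sq_sqrt hB0.le]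
  refine le_of_mul_le_mul_left ?_ hη0
  linarith

end MirrorDescent

/-! ### The stopping time -/

section StopTime

variable {E : Type*} [NormedAddCommGroup E] [NormedSpace ℝ E] {V : Set E} {T : ℕ} {v : ℕ → E}

lemma stopTime_le : stopTime V T v ≤ T := by
  classical
  unfold stopTime
  split_ifs with h
  · exact (Nat.find_spec h).2.1
  · exact le_rfl

/-- Only `v 0, …, v (t - 1)` occur on the right, so whether round `t` is played is decided by the
past. -/
lemma lt_stopTime_iff {t : ℕ} : t < stopTime V T v ↔
    t < T ∧ ∀ s ≤ t, 1 ≤ s → (T : ℝ)⁻¹ • ∑ i ∈ Finset.range s, v i ∈ V := by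
  classical
  constructor
  · intro ht
    have htT : t < T := ht.trans_le stopTime_le
    refine ⟨htT, fun s hs hs1 => ?_⟩
    by_contra hsV
    have h : ∃ t, 1 ≤ t ∧ t ≤ T ∧ (T : ℝ)⁻¹ • ∑ s ∈ Finset.range t, v s ∉ V :=
      ⟨s, hs1, hs.trans htT.le, hsV⟩
    rw [stopTime, dif_pos h] at ht
    exact absurd (Nat.find_min' h ⟨hs1, hs.trans htT.le, hsV⟩) (by omega)
  · rintro ⟨htT, hV⟩
    unfold stopTime
    split_ifs with h
    · by_contra! hle
      exact (Nat.find_spec h).2.2 (hV _ hle (Nat.find_spec h).1)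
    · exact htT

lemma not_mem_of_stopTime_lt (h : stopTime V T v < T) :
    (T : ℝ)⁻¹ • ∑ i ∈ Finset.range (stopTime V T v), v i ∉ V := by
  classical
  by_cases h' : ∃ t, 1 ≤ t ∧ t ≤ T ∧ (T : ℝ)⁻¹ • ∑ s ∈ Finset.range t, v s ∉ V
  · rw [stopTime, dif_pos h']
    exact (Nat.find_spec h').2.2
  · rw [stopTime, dif_neg h'] at h
    exact absurd h (lt_irrefl _)

end StopTime

/-! ### Freezing an independent variable -/

section Independence

variable {Ω 𝒟 𝒵 : Type*} [MeasurableSpace Ω] [MeasurableSpace 𝒟] [MeasurableSpace 𝒵]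
  {Pr : Measure Ω} [IsProbabilityMeasure Pr] {D : Ω → 𝒟} {Z : Ω → 𝒵} {F : 𝒟 → 𝒵 → ℝ}

lemma integrable_integral_of_indepFun (hD : Measurable D) (hZ : Measurable Z)
    (hDZ : IndepFun D Z Pr) (hF : Measurable (Function.uncurry F))
    (hint : Integrable (fun o => F (D o) (Z o)) Pr) :
    Integrable (fun o => ∫ z, F (D o) z ∂(Pr.map Z)) Pr ∧
      ∫ o, F (D o) (Z o) ∂Pr = ∫ o, ∫ z, F (D o) z ∂(Pr.map Z) ∂Pr := by
  have hmap := (indepFun_iff_map_prod_eq_prod_map_map hD.aemeasurable hZ.aemeasurable).1 hDZ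
  have := Measure.isProbabilityMeasure_map (μ := Pr) hD.aemeasurable
  have := Measure.isProbabilityMeasure_map (μ := Pr) hZ.aemeasurable
  have hint' : Integrable (Function.uncurry F) ((Pr.map D).prod (Pr.map Z)) := by
    rw [← hmap, integrable_map_measure hF.aestronglyMeasurable (hD.prodMk hZ).aemeasurable]
    exact hint
  have h1 := hint'.integral_prod_left
  refine ⟨h1.comp_measurable hD, ?_⟩
  have h2 : ∫ o, F (D o) (Z o) ∂Pr = ∫ q, Function.uncurry F q ∂(Pr.map fun o => (D o, Z o)) :=
    (integral_map (hD.prodMk hZ).aemeasurable hF.aestronglyMeasurable).symm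
  rw [h2, hmap, integral_prod _ hint']
  exact integral_map hD.aemeasurable h1.aestronglyMeasurable

end Independence

/-! ### Measurability of the dual domains -/

section Measurability

variable {E : Type*} [NormedAddCommGroup E] [NormedSpace ℝ E]

lemma measurableSet_conjDom (f : E → ℝ) : MeasurableSet (conjDom f) := by
  have : conjDom f = ⋃ n : ℕ, ⋂ x, {y : StrongDual ℝ E | y x - f x ≤ n} := by
    ext y
    simp only [mem_iUnion, mem_iInter, mem_ofPred_eq]
    constructor
    · intro hy
      obtain ⟨n, hn⟩ := exists_nat_ge (conj f y)
      exact ⟨n, fun x => (le_conj hy x).trans hn⟩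
    · rintro ⟨n, hn⟩
      exact mem_conjDom_of_le hn
  rw [this]
  -- The intersection is uncountable, but each set in it is closed.
  refine MeasurableSet.iUnion fun n => (isClosed_iInter fun x => ?_).measurableSet
  exact isClosed_le (by fun_prop) continuous_const

end Measurability

/-! ### Costs, Bayes predictor and weak duality -/

variable {X W E : Type*} [MeasurableSpace X]
  [NormedAddCommGroup W] [NormedSpace ℝ W] [NormedAddCommGroup E] [NormedSpace ℝ E]

lemma cost_apply (ζ : ℝ) (μ : Outcome W E) (ω : Duals E) (w : W) :
    cost ζ μ ω w = μ.1 w - ω.1 (μ.2 w) - ζ * ω.2 (μ.2 w) := by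
  simp [cost]

/-- The cost vector as a linear function of the outcome. -/
noncomputable def costL (W : Type*) [NormedAddCommGroup W] [NormedSpace ℝ W] (ζ : ℝ) (ω : Duals E) :
    Outcome W E →L[ℝ] StrongDual ℝ W :=
  ContinuousLinearMap.fst ℝ _ _ -
    (ContinuousLinearMap.compL ℝ W E ℝ ω.1).comp (ContinuousLinearMap.snd ℝ _ _) -
    ζ • (ContinuousLinearMap.compL ℝ W E ℝ ω.2).comp (ContinuousLinearMap.snd ℝ _ _)

lemma costL_apply (ζ : ℝ) (ω : Duals E) (μ : Outcome W E) : costL W ζ ω μ = cost ζ μ ω := by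
  simp [costL, cost]

variable [MeasurableSpace W]

lemma measurable_cost_apply [FiniteDimensional ℝ W] [BorelSpace W] [FiniteDimensional ℝ E]
    (ζ : ℝ) : Measurable fun q : Outcome W E × Duals E × W => cost ζ q.1 q.2.1 q.2.2 := by
  have : Continuous fun q : Outcome W E × Duals E × W => cost ζ q.1 q.2.1 q.2.2 := by
    simp only [cost_apply]
    fun_prop
  exact this.measurable

namespace Problem

variable (p : Problem X W E)

lemma lipschitz_negU : LipschitzWith p.L p.negU := p.lipschitz_u.neg

lemma convexOn_negU : ConvexOn ℝ univ p.negU := p.concave_u.neg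

lemma lipschitz_distV : LipschitzWith 1 p.distV := Metric.lipschitz_infDist_pt _

lemma negU_zero : p.negU 0 = 0 := by simp [negU, p.u_zero]

/-- A common bound for decisions, rewards, consumption and costs. -/
lemma exists_bound {ζ : ℝ} (hζ : 0 < ζ) : ∃ K : ℝ, ∀ w ∈ p.S, ∀ μ : Outcome W E,
    |μ.1 w| ≤ K * ‖μ‖ ∧ ‖μ.2 w‖ ≤ K * ‖μ‖ ∧
      ∀ ω ∈ p.LamDom ×ˢ p.ThDom, |cost ζ μ ω w| ≤ K * ‖μ‖ := by
  obtain ⟨K, hK⟩ := p.compact_S.isBounded.exists_norm_le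
  have hc : 1 ≤ 1 + (p.L : ℝ) + ζ := by have := p.L.2; linarith
  -- The summands come from the reward, from `‖λ‖ ≤ L`, and from `‖θ‖ ≤ 1` weighted by `ζ`.
  refine ⟨(1 + p.L + ζ) * K, fun w hw μ => ?_⟩
  have hKw := hK w hw
  have hK0 : 0 ≤ K := (norm_nonneg _).trans hKw
  have h1 : |μ.1 w| ≤ K * ‖μ‖ := by
    refine (μ.1.le_opNorm w).trans ?_
    rw [mul_comm]
    exact mul_le_mul hKw (norm_fst_le μ) (norm_nonneg _) hK0
  have h2 : ‖μ.2 w‖ ≤ K * ‖μ‖ := by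
    refine (μ.2.le_opNorm w).trans ?_
    rw [mul_comm]
    exact mul_le_mul hKw (norm_snd_le μ) (norm_nonneg _) hK0
  have hKμ : 0 ≤ K * ‖μ‖ := mul_nonneg hK0 (norm_nonneg _)
  have h3 : K * ‖μ‖ ≤ (1 + p.L + ζ) * K * ‖μ‖ := by
    rw [mul_assoc]; exact le_mul_of_one_le_left hKμ hc
  refine ⟨h1.trans h3, h2.trans h3, fun ω hω => ?_⟩
  rw [cost_apply]
  have h4 : |ω.1 (μ.2 w)| ≤ p.L * (K * ‖μ‖) := (ω.1.le_opNorm _).trans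
    (mul_le_mul (norm_le_of_mem_conjDom p.lipschitz_negU hω.1) h2 (norm_nonneg _) p.L.2)
  have h5 : |ω.2 (μ.2 w)| ≤ 1 * (K * ‖μ‖) := (ω.2.le_opNorm _).trans
    (mul_le_mul (norm_le_of_mem_conjDom p.lipschitz_distV hω.2) h2 (norm_nonneg _) zero_le_one)
  have h6 : |ζ * ω.2 (μ.2 w)| ≤ ζ * (K * ‖μ‖) := by
    rw [abs_mul, abs_of_pos hζ]
    exact mul_le_mul_of_nonneg_left (by linarith) hζ.le
  calc _ ≤ |μ.1 w| + |ω.1 (μ.2 w)| + |ζ * ω.2 (μ.2 w)| :=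
        (abs_sub _ _).trans (add_le_add_left (abs_sub _ _) _)
    _ ≤ _ := by nlinarith

section StaticPolicies

variable {p} [FiniteDimensional ℝ W] [BorelSpace W] {ζ : ℝ}

lemma integrable_reward (hζ : 0 < ζ) {w : X → W} (hw : Measurable w) (hwS : ∀ x, w x ∈ p.S) :
    Integrable (fun z : X × Outcome W E => z.2.1 (w z.1)) p.P := by
  obtain ⟨K, hK⟩ := p.exists_bound hζ
  refine (p.integrable_outcome.norm.const_mul K).mono' ?_
    (ae_of_all _ fun z => (hK _ (hwS z.1) z.2).1)
  have hc : Continuous fun q : StrongDual ℝ W × W => q.1 q.2 := by fun_prop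
  exact (hc.measurable.comp (measurable_snd.fst.prodMk
    (hw.comp measurable_fst))).aestronglyMeasurable

variable [FiniteDimensional ℝ E]

lemma integrable_consumption (hζ : 0 < ζ) {w : X → W} (hw : Measurable w)
    (hwS : ∀ x, w x ∈ p.S) : Integrable (fun z : X × Outcome W E => z.2.2 (w z.1)) p.P := by
  borelize E
  obtain ⟨K, hK⟩ := p.exists_bound hζ
  refine (p.integrable_outcome.norm.const_mul K).mono' ?_
    (ae_of_all _ fun z => (hK _ (hwS z.1) z.2).2.1)
  have hc : Continuous fun q : (W →L[ℝ] E) × W => q.1 q.2 := by fun_prop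
  exact (hc.measurable.comp (measurable_snd.snd.prodMk
    (hw.comp measurable_fst))).aestronglyMeasurable

lemma integrable_cost (hζ : 0 < ζ) {ω : Duals E} (hω : ω ∈ p.LamDom ×ˢ p.ThDom) {w : X → W}
    (hw : Measurable w) (hwS : ∀ x, w x ∈ p.S) :
    Integrable (fun z : X × Outcome W E => cost ζ z.2 ω (w z.1)) p.P := by
  obtain ⟨K, hK⟩ := p.exists_bound hζ
  refine (p.integrable_outcome.norm.const_mul K).mono' ?_
    (ae_of_all _ fun z => (hK _ (hwS z.1) z.2).2.2 ω hω)
  exact ((measurable_cost_apply ζ).comp (measurable_snd.prodMk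
    (measurable_const.prodMk (hw.comp measurable_fst)))).aestronglyMeasurable

/-- The decision depends on the feature alone and the cost is bilinear in outcome and decision, so
the decision can be pulled out of the conditional expectation. -/
lemma integral_cost_bayes {gstar : X → Outcome W E} (hg : p.IsBayes gstar) (hζ : 0 < ζ)
    {ω : Duals E} (hω : ω ∈ p.LamDom ×ˢ p.ThDom) {w : X → W} (hw : Measurable w)
    (hwS : ∀ x, w x ∈ p.S) :
    Integrable (fun z : X × Outcome W E => cost ζ (gstar z.1) ω (w z.1)) p.P ∧
      ∫ z, cost ζ (gstar z.1) ω (w z.1) ∂p.P = ∫ z, cost ζ z.2 ω (w z.1) ∂p.P := by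
  have hm : MeasurableSpace.comap (Prod.fst : X × Outcome W E → X) inferInstance ≤
      (inferInstance : MeasurableSpace (X × Outcome W E)) := measurable_fst.comap_le
  have hint := integrable_cost hζ hω hw hwS
  have hwm : StronglyMeasurable[MeasurableSpace.comap (Prod.fst : X × Outcome W E → X)
      inferInstance] fun z : X × Outcome W E => w z.1 :=
    (hw.comp (comap_measurable Prod.fst)).stronglyMeasurable
  have hB : ∀ (μ : Outcome W E) (w : W), (costL W ζ ω).flip w μ = cost ζ μ ω w := fun μ w => by
    rw [ContinuousLinearMap.flip_apply, costL_apply]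
  have hpull := condExp_bilin_of_stronglyMeasurable_left (μ := p.P) (costL W ζ ω).flip hwm
    (g := fun z : X × Outcome W E => z.2) (by simpa only [hB] using hint) p.integrable_outcome
  have heq : (fun z : X × Outcome W E => cost ζ (gstar z.1) ω (w z.1)) =ᵐ[p.P]
      (p.P)[fun z : X × Outcome W E => cost ζ z.2 ω (w z.1) |
        MeasurableSpace.comap Prod.fst inferInstance] := by
    simp only [hB] at hpull
    filter_upwards [hg.2, hpull] with z h1 h2
    rw [h2, h1]
  exact ⟨integrable_condExp.congr heq.symm, by rw [integral_congr_ae heq, integral_condExp hm]⟩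

end StaticPolicies

end Problem

namespace Method

variable {p : Problem X W E} {ζ : ℝ} (M : Method p ζ)

/-- The expected cost of the decisions induced by the prediction model `g`. -/
noncomputable def decisionValue (g : X → Outcome W E) (ω : Duals E) : ℝ :=
  ∫ z, cost ζ z.2 ω (M.wstar (g z.1) ω) ∂p.P

lemma measurable_wstar_comp {g : X → Outcome W E} (hg : Measurable g) (ω : Duals E) :
    Measurable fun x => M.wstar (g x) ω := M.wstar_meas.comp (hg.prodMk measurable_const)

lemma measurable_decision {Ω : Type*} {_ : MeasurableSpace Ω} {z : ℕ → Ω → X × Outcome W E}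
    {lam th : ℕ → Ω → StrongDual ℝ E} {t : ℕ} (hz : ∀ i ≤ t, Measurable (z i))
    (hlam : Measurable (lam t)) (hth : Measurable (th t)) :
    Measurable (M.decision z lam th t) := by
  have hmodel : Measurable fun o => M.model z lam th t o (z t o).1 := by
    rcases Nat.eq_zero_or_pos t with rfl | ht
    · exact M.g₁_meas.comp (hz 0 le_rfl).fst
    · have h : (fun o => M.model z lam th t o (z t o).1) =
          fun o => M.erm t (fun i : Fin t => z i o) (lam t o, th t o) (z t o).1 := by
        funext o
        rw [model, if_neg ht.ne']
      rw [h]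
      have hhist : Measurable fun o => fun i : Fin t => z i o :=
        measurable_pi_lambda _ fun i => hz i i.isLt.le
      exact (M.erm_meas t ht).comp (hhist.prodMk ((hlam.prodMk hth).prodMk (hz t le_rfl).fst))
  exact M.wstar_meas.comp (hmodel.prodMk (hlam.prodMk hth))

variable [FiniteDimensional ℝ W] [BorelSpace W]

lemma measurable_consumption [MeasurableSpace E] [BorelSpace E] {Ω : Type*} {_ : MeasurableSpace Ω}
    {z : ℕ → Ω → X × Outcome W E} {lam th : ℕ → Ω → StrongDual ℝ E} {t : ℕ}
    (hz : ∀ i ≤ t, Measurable (z i)) (hlam : Measurable (lam t)) (hth : Measurable (th t)) :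
    Measurable (M.consumption z lam th t) := by
  have hc : Continuous fun q : (W →L[ℝ] E) × W => q.1 q.2 := by fun_prop
  exact hc.measurable.comp ((hz t le_rfl).snd.snd.prodMk (M.measurable_decision hz hlam hth))

variable [FiniteDimensional ℝ E]

/-- Once the outcome is replaced by its conditional mean on both sides, the oracle at `gstar` is
optimal for every feature. -/
lemma integral_cost_le_decisionValue {gstar : X → Outcome W E} (hg : p.IsBayes gstar)
    (hζ : 0 < ζ) {ω : Duals E} (hω : ω ∈ p.LamDom ×ˢ p.ThDom) {w : X → W} (hw : Measurable w)
    (hwS : ∀ x, w x ∈ p.S) : ∫ z, cost ζ z.2 ω (w z.1) ∂p.P ≤ M.decisionValue gstar ω := by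
  have h1 := Problem.integral_cost_bayes hg hζ hω hw hwS
  have h2 := Problem.integral_cost_bayes hg hζ hω (M.measurable_wstar_comp hg.1 ω)
    fun x => M.wstar_mem _ ω hω
  rw [decisionValue, ← h1.2, ← h2.2]
  exact integral_mono h1.1 h2.1 fun z => M.wstar_max _ ω hω _ (hwS z.1)

lemma decisionValue_le {gstar g : X → Outcome W E} (hgstar : p.IsBayes gstar) (hg : Measurable g)
    (hζ : 0 < ζ) {ω : Duals E} (hω : ω ∈ p.LamDom ×ˢ p.ThDom) :
    M.decisionValue g ω ≤ M.decisionValue gstar ω :=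
  M.integral_cost_le_decisionValue hgstar hζ hω (M.measurable_wstar_comp hg ω)
    fun _ => M.wstar_mem _ ω hω

/-- The full-information term `w*(μ; ω)` is common to both risks and cancels. -/
lemma spoRisk_sub {gstar g : X → Outcome W E} (hgstar : Measurable gstar) (hg : Measurable g)
    (hζ : 0 < ζ) {ω : Duals E} (hω : ω ∈ p.LamDom ×ˢ p.ThDom) :
    M.spoRisk g ω - M.spoRisk gstar ω = M.decisionValue gstar ω - M.decisionValue g ω := by
  have hint : ∀ {g : X → Outcome W E}, Measurable g → Integrable
      (fun z : X × Outcome W E => cost ζ z.2 ω (M.wstar (g z.1) ω)) p.P := fun hg =>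
    Problem.integrable_cost hζ hω (M.measurable_wstar_comp hg ω) fun _ => M.wstar_mem _ ω hω
  have hfull : Integrable (fun z : X × Outcome W E => cost ζ z.2 ω (M.wstar z.2 ω)) p.P := by
    obtain ⟨K, hK⟩ := p.exists_bound hζ
    refine (p.integrable_outcome.norm.const_mul K).mono' ?_
      (ae_of_all _ fun z => (hK _ (M.wstar_mem _ ω hω) z.2).2.2 ω hω)
    exact ((measurable_cost_apply ζ).comp (measurable_snd.prodMk (measurable_const.prodMk
      (M.wstar_meas.comp (measurable_snd.prodMk measurable_const))))).aestronglyMeasurable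
  have key : ∀ {g : X → Outcome W E}, Measurable g → M.spoRisk g ω =
      ∫ z, cost ζ z.2 ω (M.wstar z.2 ω) ∂p.P - M.decisionValue g ω := fun hg => by
    simp only [spoRisk, spoLoss, map_sub, decisionValue]
    exact integral_sub hfull (hint hg)
  rw [key hg, key hgstar]
  ring

/-- Weak duality: the benchmark is bounded by the dual objective. -/
lemma OPT_le {gstar : X → Outcome W E} (hgstar : p.IsBayes gstar) (hζ : 0 < ζ)
    (hfeas : ∃ π, p.IsFeasiblePolicy π) {ω : Duals E} (hω : ω ∈ p.LamDom ×ˢ p.ThDom) :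
    p.OPT ≤ M.decisionValue gstar ω + conj p.negU ω.1 + ζ * conj p.distV ω.2 := by
  refine csSup_le ?_ ?_
  · obtain ⟨π, hπ⟩ := hfeas
    exact ⟨_, π, hπ, rfl⟩
  rintro _ ⟨π, hπ, rfl⟩
  have h1 := M.integral_cost_le_decisionValue hgstar hζ hω hπ.1 hπ.2.1
  have hr := Problem.integrable_reward hζ hπ.1 hπ.2.1
  have hv := Problem.integrable_consumption hζ hπ.1 hπ.2.1
  have hA : Integrable (fun z : X × Outcome W E => z.2.1 (π z.1) - ω.1 (z.2.2 (π z.1))) p.P :=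
    hr.sub (ω.1.integrable_comp hv)
  have h2 : ∫ z, cost ζ z.2 ω (π z.1) ∂p.P =
      p.rew π - ω.1 (p.con π) - ζ * ω.2 (p.con π) := by
    simp only [cost_apply]
    rw [integral_sub hA ((ω.2.integrable_comp hv).const_mul ζ),
      integral_sub hr (ω.1.integrable_comp hv), integral_const_mul,
      ω.1.integral_comp_comm hv, ω.2.integral_comp_comm hv]
    rfl
  -- Fenchel's inequality at the mean consumption, for `-u` and for `d_V`; feasibility makes the
  -- distance vanish.
  have h3 := le_conj hω.1 (p.con π)
  have h4 := le_conj hω.2 (p.con π)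
  have h5 : p.distV (p.con π) = 0 := Metric.infDist_zero_of_mem hπ.2.2
  have h6 := mul_le_mul_of_nonneg_left h4 hζ.le
  simp only [Problem.negU] at h3
  rw [h5, sub_zero] at h6
  have h7 : conj p.negU ω.1 = conj (fun v => -p.u v) ω.1 := rfl
  linarith

lemma measurable_decisionValue {𝒟 : Type*} [MeasurableSpace 𝒟] {g : 𝒟 → X → Outcome W E}
    (hg : Measurable (Function.uncurry g)) {ω : 𝒟 → Duals E} (hω : Measurable ω) :
    Measurable fun D => M.decisionValue (g D) (ω D) := by
  have h : Measurable fun q : 𝒟 × (X × Outcome W E) =>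
      cost ζ q.2.2 (ω q.1) (M.wstar (g q.1 q.2.1) (ω q.1)) := by
    have h1 : Measurable fun q : 𝒟 × (X × Outcome W E) => ω q.1 := hω.comp measurable_fst
    have h2 : Measurable fun q : 𝒟 × (X × Outcome W E) => g q.1 q.2.1 :=
      hg.comp (measurable_fst.prodMk measurable_snd.fst)
    have h3 : Measurable fun q : 𝒟 × (X × Outcome W E) => M.wstar (g q.1 q.2.1) (ω q.1) :=
      M.wstar_meas.comp (h2.prodMk h1)
    have h4 : Measurable fun q : 𝒟 × (X × Outcome W E) => q.2.2 := measurable_snd.snd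
    have h5 : Measurable fun q : 𝒟 × (X × Outcome W E) =>
        ((q.2.2, ω q.1, M.wstar (g q.1 q.2.1) (ω q.1)) : Outcome W E × Duals E × W) :=
      h4.prodMk (h1.prodMk h3)
    have h6 := (measurable_cost_apply (W := W) (E := E) ζ).comp h5
    simpa only [Function.comp_def] using h6
  exact (h.stronglyMeasurable.integral_prod_right' (ν := p.P)).measurable

end Method

lemma measurableSet_smul_sum_mem {Ω E : Type*} {_ : MeasurableSpace Ω} [NormedAddCommGroup E]
    [NormedSpace ℝ E] [FiniteDimensional ℝ E] [MeasurableSpace E] [BorelSpace E] {V : Set E}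
    (hV : MeasurableSet V) (c : ℝ) {s : Finset ℕ} {f : ℕ → Ω → E}
    (hf : ∀ i ∈ s, Measurable (f i)) : MeasurableSet ((fun o => c • ∑ i ∈ s, f i o) ⁻¹' V) :=
  (Finset.measurable_fun_sum s hf).const_smul c hV

/-! ### The inequality along one path -/

section Pathwise

variable {E : Type*} [NormedAddCommGroup E] [NormedSpace ℝ E]

/-- Regret of mirror descent on the conjugate of `f`, against a fixed dual vector `q`. -/
lemma sum_conj_sub_le {f : E → ℝ} {h : StrongDual ℝ E → ℝ} (hh : IsMirrorMap (conjDom f) h)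
    {B G : ℝ} (hG : 0 < G) (hB : ∀ y₁ ∈ conjDom f, ∀ y₂ ∈ conjDom f, bregman (conjDom f) h y₁ y₂ ≤ B)
    {T n : ℕ} (hT : 0 < T) (hn : n ≤ T) {y : ℕ → StrongDual ℝ E} {s v : ℕ → E}
    (hs : ∀ t < n, ‖s t‖ ≤ G)
    (hsub : ∀ t < n, IsSubgrad (conjDom f) (fun y => -y (v t) + conj f y) (y t) (s t))
    (hstep : ∀ t < n, IsMirrorStep (conjDom f) h (√B / (G * √T)) (s t) (y t) (y (t + 1)))
    {q : StrongDual ℝ E} (hq : q ∈ conjDom f) :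
    ∑ t ∈ Finset.range n, (conj f (y t) - y t (v t)) ≤
      n * conj f q - T * q ((T : ℝ)⁻¹ • ∑ t ∈ Finset.range n, v t) + 3 / 2 * (G * √B * √T) := by
  have hreg := mirrorDescent_regret (convex_conjDom f) hh hG hB hT hn (fun t ht => (hsub t ht).1)
    hs hstep hq
  have hTr : (T : ℝ) ≠ 0 := Nat.cast_ne_zero.2 hT.ne'
  have h1 : (T : ℝ) * q ((T : ℝ)⁻¹ • ∑ t ∈ Finset.range n, v t) =
      ∑ t ∈ Finset.range n, q (v t) := by
    rw [map_smul, smul_eq_mul, mul_inv_cancel_left₀ hTr, map_sum]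
  -- The subgradient inequality bounds each loss by that of `q` plus a linearized regret.
  have h2 : ∑ t ∈ Finset.range n, (conj f (y t) - y t (v t)) ≤
      ∑ t ∈ Finset.range n, (conj f q - q (v t) + (y t - q) (s t)) := by
    refine Finset.sum_le_sum fun t ht => ?_
    have := (hsub t (Finset.mem_range.1 ht)).2 q hq
    simp only [sub_apply] at this ⊢
    linarith
  have h3 : ∑ t ∈ Finset.range n, (conj f q - q (v t)) =
      n * conj f q - ∑ t ∈ Finset.range n, q (v t) := by
    rw [Finset.sum_sub_distrib, Finset.sum_const, Finset.card_range, nsmul_eq_mul]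
  rw [h1]
  rw [Finset.sum_add_distrib, h3] at h2
  linarith

variable {X W : Type*} [MeasurableSpace X] [NormedAddCommGroup W] [NormedSpace ℝ W]
  [MeasurableSpace W]

/-- This is deterministic. The dual bounds `hb` cover the played rounds; the θ-regret covers the
missing `T - n` ones. -/
lemma Problem.mul_OPT_le_of_path (p : Problem X W E) {ζ : ℝ} (hζ : 0 < ζ)
    (hOPT : ENNReal.ofReal p.OPT / boundaryDist p.V ≤ ENNReal.ofReal ζ)
    {hLam hTh : StrongDual ℝ E → ℝ}
    (hmLam : IsMirrorMap p.LamDom hLam) (hmTh : IsMirrorMap p.ThDom hTh)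
    {DLam DTh GLam GTh : ℝ} (hGLam : 0 < GLam) (hGTh : 0 < GTh)
    (hDLam : ∀ y₁ ∈ p.LamDom, ∀ y₂ ∈ p.LamDom, bregman p.LamDom hLam y₁ y₂ ≤ DLam)
    (hDTh : ∀ y₁ ∈ p.ThDom, ∀ y₂ ∈ p.ThDom, bregman p.ThDom hTh y₁ y₂ ≤ DTh)
    {T : ℕ} (hT : 0 < T) {v subLam subTh : ℕ → E} {lam th : ℕ → StrongDual ℝ E} {b : ℕ → ℝ}
    (hsubLam : ∀ t < stopTime p.V T v, IsSubgrad p.LamDom (p.xi (v t)) (lam t) (subLam t))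
    (hsubTh : ∀ t < stopTime p.V T v, IsSubgrad p.ThDom (p.phi (v t)) (th t) (subTh t))
    (hstepLam : ∀ t < stopTime p.V T v,
      IsMirrorStep p.LamDom hLam (√DLam / (GLam * √T)) (subLam t) (lam t) (lam (t + 1)))
    (hstepTh : ∀ t < stopTime p.V T v,
      IsMirrorStep p.ThDom hTh (√DTh / (GTh * √T)) (subTh t) (th t) (th (t + 1)))
    (hnLam : ∀ t < stopTime p.V T v, ‖subLam t‖ ≤ GLam)
    (hnTh : ∀ t < stopTime p.V T v, ‖subTh t‖ ≤ GTh)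
    (hb : ∀ t < stopTime p.V T v,
      p.OPT ≤ b t + conj p.negU (lam t) + ζ * conj p.distV (th t)) :
    T * p.OPT ≤ ∑ t ∈ Finset.range (stopTime p.V T v), (b t + lam t (v t) + ζ * th t (v t)) +
      T * p.u ((T : ℝ)⁻¹ • ∑ t ∈ Finset.range (stopTime p.V T v), v t) +
      (3 / 2 * (GLam * √DLam * √T) + ζ * (3 / 2 * (GTh * √DTh * √T))) := by
  set n := stopTime p.V T v
  have hn : n ≤ T := stopTime_le
  have hnr : (n : ℝ) ≤ T := Nat.cast_le.2 hn
  set vbar := (T : ℝ)⁻¹ • ∑ t ∈ Finset.range n, v t with hvbar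
  obtain ⟨q, hq, hqc⟩ := exists_conj_eq p.convexOn_negU p.lipschitz_negU.continuous vbar
  have h1 := sum_conj_sub_le hmLam hGLam hDLam hT hn hnLam hsubLam hstepLam hq
  have hq0 := conj_nonneg p.negU_zero hq
  -- Since `u 0 = 0`, the conjugate is nonnegative, so `n` may be raised to `T` before equality at
  -- `vbar` is used.
  have h2 : n * conj p.negU q - T * q vbar ≤ T * p.u vbar := by
    have : T * conj p.negU q - T * q vbar = T * p.u vbar := by
      rw [hqc, Problem.negU]; ring
    have := mul_le_mul_of_nonneg_right hnr hq0
    linarith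
  have h3 : ζ * ∑ t ∈ Finset.range n, (conj p.distV (th t) - th t (v t)) ≤
      -((T - n) * p.OPT) + ζ * (3 / 2 * (GTh * √DTh * √T)) := by
    -- After an early stop, the separating comparator gives at most `-(T - n) * ζ * d_V*(θ)`, hence
    -- at most `-(T - n) * OPT`. Otherwise no round is missing and the comparator is `0`.
    rcases hn.lt_or_eq with hlt | heq
    · obtain ⟨θ, hθ, hθ1, hθ2⟩ := exists_separating p.convex_V p.closed_V p.zero_mem_V
        (not_mem_of_stopTime_lt hlt) hζ hOPT
      have h4 := sum_conj_sub_le hmTh hGTh hDTh hT hn hnTh hsubTh hstepTh hθ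
      have h5 := mul_le_mul_of_nonneg_left h4 hζ.le
      have h6 : (T - n) * p.OPT ≤ (T - n) * (ζ * conj p.distV θ) :=
        mul_le_mul_of_nonneg_left hθ2 (by linarith)
      have h7 : ζ * (T * conj p.distV θ) ≤ ζ * (T * θ vbar) :=
        mul_le_mul_of_nonneg_left (mul_le_mul_of_nonneg_left hθ1 (Nat.cast_nonneg _)) hζ.le
      rw [← hvbar] at h5
      linarith
    · have h0 : ∀ x, (0 : StrongDual ℝ E) x - p.distV x ≤ 0 := fun x => by
        simpa using! (Metric.infDist_nonneg : 0 ≤ Metric.infDist x p.V)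
      have h4 := sum_conj_sub_le hmTh hGTh hDTh hT hn hnTh hsubTh hstepTh (mem_conjDom_of_le h0)
      have h5 : n * conj p.distV 0 ≤ 0 :=
        mul_nonpos_of_nonneg_of_nonpos (Nat.cast_nonneg _) (conj_le h0)
      have h6 : ∑ t ∈ Finset.range n, (conj p.distV (th t) - th t (v t)) ≤
          3 / 2 * (GTh * √DTh * √T) := by
        simp only [zero_apply, mul_zero, sub_zero] at h4
        linarith
      rw [heq, sub_self, zero_mul, neg_zero, zero_add]
      exact mul_le_mul_of_nonneg_left (by simpa [heq] using h6) hζ.le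
  have h4 : n * p.OPT ≤ ∑ t ∈ Finset.range n,
      (b t + conj p.negU (lam t) + ζ * conj p.distV (th t)) := by
    have := Finset.sum_le_sum fun t ht => hb t (Finset.mem_range.1 ht)
    simpa using this
  have h5 : ∑ t ∈ Finset.range n, (b t + conj p.negU (lam t) + ζ * conj p.distV (th t)) =
      ∑ t ∈ Finset.range n, (b t + lam t (v t) + ζ * th t (v t)) +
      ∑ t ∈ Finset.range n, (conj p.negU (lam t) - lam t (v t)) +
      ζ * ∑ t ∈ Finset.range n, (conj p.distV (th t) - th t (v t)) := by
    rw [Finset.mul_sum, ← Finset.sum_add_distrib, ← Finset.sum_add_distrib]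
    exact Finset.sum_congr rfl fun t _ => by ring
  have h6 : (T : ℝ) * p.OPT = n * p.OPT + (T - n) * p.OPT := by ring
  linarith

end Pathwise

/-! ### Conditioning on the history of a run -/

namespace Method

variable {X W E : Type*} [MeasurableSpace X]
  [NormedAddCommGroup W] [NormedSpace ℝ W] [MeasurableSpace W]
  [NormedAddCommGroup E] [NormedSpace ℝ E]
  {p : Problem X W E} {ζ : ℝ} {M : Method p ζ}

lemma exists_decisionValue_bound (M : Method p ζ) (hζ : 0 < ζ) :
    ∃ K : ℝ, ∀ g : X → Outcome W E, ∀ ω ∈ p.LamDom ×ˢ p.ThDom, |M.decisionValue g ω| ≤ K := by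
  obtain ⟨K, hK⟩ := p.exists_bound hζ
  refine ⟨∫ z, K * ‖z.2‖ ∂p.P, fun g ω hω => ?_⟩
  rw [decisionValue, ← Real.norm_eq_abs]
  exact norm_integral_le_of_norm_le (p.integrable_outcome.norm.const_mul K)
    (ae_of_all _ fun z => (hK _ (M.wstar_mem _ ω hω) z.2).2.2 ω hω)

namespace Run

variable {T : ℕ} {ηLam ηTh : ℝ} {Ω : Type*} [MeasurableSpace Ω] {Pr : Measure Ω}
  (R : M.Run T ηLam ηTh Pr)

/-- The samples observed before round `t`. -/
def hist (t : ℕ) (o : Ω) : Fin t → X × Outcome W E := fun i => R.z i o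

/-- The dual variables of round `t`. -/
def dual (t : ℕ) (o : Ω) : Duals E := (R.lam t o, R.th t o)

/-- The event that round `t` is played, with dual variables in their domain. -/
def active (t : ℕ) : Set Ω := {o | t < R.tau o ∧ R.dual t o ∈ p.LamDom ×ˢ p.ThDom}

lemma measurable_hist (t : ℕ) : Measurable (R.hist t) :=
  measurable_pi_lambda _ fun i => R.z_meas i

lemma comap_hist (t : ℕ) : MeasurableSpace.comap (R.hist t) inferInstance =
    ⨆ i : Fin t, MeasurableSpace.comap (R.z i) inferInstance := by
  change MeasurableSpace.comap (R.hist t) (⨆ a, MeasurableSpace.comap (fun b => b a) _) = _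
  rw [MeasurableSpace.comap_iSup]
  simp only [MeasurableSpace.comap_comp]
  rfl

lemma comap_hist_mono {s t : ℕ} (h : s ≤ t) :
    (⨆ i : Fin s, MeasurableSpace.comap (R.z i) inferInstance) ≤
      MeasurableSpace.comap (R.hist t) inferInstance := by
  rw [comap_hist]
  exact iSup_le fun i => le_iSup (fun j : Fin t => MeasurableSpace.comap (R.z j) inferInstance)
    ⟨i, i.isLt.trans_le h⟩

lemma measurable_z_hist {i t : ℕ} (h : i < t) :
    Measurable[MeasurableSpace.comap (R.hist t) inferInstance] (R.z i) :=
  (measurable_pi_apply (⟨i, h⟩ : Fin t)).comp (comap_measurable (R.hist t))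

lemma measurable_lam_hist {s t : ℕ} (h : s ≤ t) :
    Measurable[MeasurableSpace.comap (R.hist t) inferInstance] (R.lam s) :=
  (R.lam_adapted s).mono (R.comap_hist_mono h) le_rfl

lemma measurable_th_hist {s t : ℕ} (h : s ≤ t) :
    Measurable[MeasurableSpace.comap (R.hist t) inferInstance] (R.th s) :=
  (R.th_adapted s).mono (R.comap_hist_mono h) le_rfl

lemma measurable_lam (t : ℕ) : Measurable (R.lam t) :=
  (R.measurable_lam_hist le_rfl).mono (R.measurable_hist t).comap_le le_rfl

lemma measurable_th (t : ℕ) : Measurable (R.th t) :=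
  (R.measurable_th_hist le_rfl).mono (R.measurable_hist t).comap_le le_rfl

lemma measurable_dual (t : ℕ) : Measurable (R.dual t) :=
  (R.measurable_lam t).prodMk (R.measurable_th t)

lemma indepFun_hist (t : ℕ) : IndepFun (R.hist t) (R.z t) Pr := by
  have h := R.z_indep.indepFun_finset (Finset.range t) {t} (by simp) R.z_meas
  have hψ : Measurable fun a : ({t} : Finset ℕ) → X × Outcome W E =>
      a ⟨t, Finset.mem_singleton_self t⟩ := measurable_pi_apply _
  exact h.comp (φ := fun a (i : Fin t) => a ⟨i, Finset.mem_range.2 i.isLt⟩)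
    (measurable_pi_lambda _ fun i => measurable_pi_apply _) hψ

lemma map_hist [IsProbabilityMeasure Pr] (t : ℕ) :
    Pr.map (R.hist t) = Measure.pi fun _ : Fin t => p.P := by
  have h := (iIndepFun_iff_map_fun_eq_pi_map (μ := Pr) (f := fun i : Fin t => R.z i)
    fun i => (R.z_meas i).aemeasurable).1 (R.z_indep.precomp Fin.val_injective)
  simp only [R.z_law] at h
  exact h

lemma measurable_decision (t : ℕ) : Measurable (M.decision R.z R.lam R.th t) :=
  M.measurable_decision (fun i _ => R.z_meas i) (R.measurable_lam t) (R.measurable_th t)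

lemma decision_mem {t : ℕ} {o : Ω} (ho : o ∈ R.active t) :
    M.decision R.z R.lam R.th t o ∈ p.S := M.wstar_mem _ _ ho.2

lemma integrable_outcome (t : ℕ) : Integrable (fun o => (R.z t o).2) Pr := by
  have := p.integrable_outcome
  rw [← R.z_law t] at this
  exact this.comp_measurable (R.z_meas t)

/-- Being a subgradient includes membership of the domain, so the extra condition in `active` costs
only a null set, while bounds on that event hold pointwise. -/
lemma ae_active : ∀ᵐ o ∂Pr, ∀ t, t < R.tau o ↔ o ∈ R.active t := by
  filter_upwards [R.subLam_mem, R.subTh_mem] with o h1 h2 t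
  exact ⟨fun h => ⟨h, (h1 t h).1, (h2 t h).1⟩, fun h => h.1⟩

/-- A fixed index range allows the expectation to be taken term by term. -/
lemma sum_range_tau {F : Type*} [AddCommMonoid F] {o : Ω}
    (ho : ∀ t, t < R.tau o ↔ o ∈ R.active t) (f : ℕ → Ω → F) :
    ∑ t ∈ Finset.range (R.tau o), f t o =
      ∑ t ∈ Finset.range T, (R.active t).indicator (f t) o := by
  classical
  have hle : R.tau o ≤ T := stopTime_le
  rw [← Finset.sum_subset (Finset.range_mono hle)]
  · refine Finset.sum_congr rfl fun t ht => ?_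
    rw [indicator_of_mem ((ho t).1 (Finset.mem_range.1 ht))]
  · intro t _ ht
    exact indicator_of_notMem (fun h => ht (Finset.mem_range.2 ((ho t).2 h))) _

section

variable [FiniteDimensional ℝ W] [BorelSpace W] [FiniteDimensional ℝ E]

lemma measurableSet_active_hist (t : ℕ) :
    MeasurableSet[MeasurableSpace.comap (R.hist t) inferInstance] (R.active t) := by
  borelize E
  have h1 : MeasurableSet[MeasurableSpace.comap (R.hist t) inferInstance]
      {o | R.dual t o ∈ p.LamDom ×ˢ p.ThDom} :=
    ((R.measurable_lam_hist le_rfl).prodMk (R.measurable_th_hist le_rfl))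
      ((measurableSet_conjDom _).prod (measurableSet_conjDom _))
  have h2 : {o | t < R.tau o} = if t < T then ⋂ s ∈ Finset.Icc 1 t,
      (fun o => (T : ℝ)⁻¹ • ∑ i ∈ Finset.range s, M.consumption R.z R.lam R.th i o) ⁻¹' p.V
      else ∅ := by
    ext o
    change t < stopTime _ _ _ ↔ _
    rw [lt_stopTime_iff]
    split_ifs with h
    · simp only [h, true_and, Finset.mem_Icc, mem_iInter, mem_preimage]
      exact ⟨fun h s hs => h s hs.2 hs.1, fun h s h1 h2 => h s ⟨h2, h1⟩⟩
    · simp [h]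
  refine MeasurableSet.inter (s₁ := {o | t < R.tau o}) ?_ h1
  rw [h2]
  split_ifs
  · refine Finset.measurableSet_biInter _ fun s hs => ?_
    refine measurableSet_smul_sum_mem p.closed_V.measurableSet _ fun i hi => ?_
    have hit : i < t := (Finset.mem_range.1 hi).trans_le (Finset.mem_Icc.1 hs).2
    exact M.measurable_consumption (fun j hj => R.measurable_z_hist (hj.trans_lt hit))
      (R.measurable_lam_hist hit.le) (R.measurable_th_hist hit.le)
  · exact @MeasurableSet.empty _ (_)

lemma measurableSet_active (t : ℕ) : MeasurableSet (R.active t) :=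
  (R.measurable_hist t).comap_le _ (R.measurableSet_active_hist t)

/-- The event `active t`, the dual variables and the prediction model of round `t` are measurable
functions of the history. -/
lemma exists_factorization (t : ℕ) : ∃ (A : Set (Fin t → X × Outcome W E))
    (ω : (Fin t → X × Outcome W E) → Duals E)
    (g : (Fin t → X × Outcome W E) → X → Outcome W E),
    MeasurableSet A ∧ Measurable ω ∧ Measurable (Function.uncurry g) ∧
    R.active t = R.hist t ⁻¹' A ∧ (∀ D ∈ A, ω D ∈ p.LamDom ×ˢ p.ThDom) ∧
    (∀ o, R.dual t o = ω (R.hist t o)) ∧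
    (∀ o, M.model R.z R.lam R.th t o = g (R.hist t o)) ∧
    (0 < t → ∀ D, g D = M.erm t D (ω D)) := by
  obtain ⟨A, hA, hAeq⟩ := R.measurableSet_active_hist t
  obtain ⟨lamf, hlamf, hlam⟩ := (R.measurable_lam_hist (le_refl t)).exists_eq_measurable_comp
  obtain ⟨thf, hthf, hth⟩ := (R.measurable_th_hist (le_refl t)).exists_eq_measurable_comp
  have hω : Measurable fun D => ((lamf D, thf D) : Duals E) := hlamf.prodMk hthf
  have hdual : ∀ o, R.dual t o = (lamf (R.hist t o), thf (R.hist t o)) := fun o => by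
    rw [dual, hlam, hth]; rfl
  -- The intersection puts `ω D` in the domain for every `D ∈ A`, including histories that no path
  -- realizes.
  refine ⟨A ∩ (fun D => (lamf D, thf D)) ⁻¹' (p.LamDom ×ˢ p.ThDom), fun D => (lamf D, thf D),
    fun D => if t = 0 then M.g₁ else M.erm t D (lamf D, thf D),
    hA.inter (hω ((measurableSet_conjDom _).prod (measurableSet_conjDom _))), hω, ?_, ?_,
    fun D hD => hD.2, hdual, fun o => ?_, fun ht D => if_neg ht.ne'⟩
  · rcases Nat.eq_zero_or_pos t with rfl | ht
    · simpa [Function.uncurry_def] using! M.g₁_meas.comp measurable_snd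
    · simp only [ht.ne', if_false, Function.uncurry_def]
      exact (M.erm_meas t ht).comp (measurable_fst.prodMk
        ((hω.comp measurable_fst).prodMk measurable_snd))
  · rw [preimage_inter, hAeq]
    ext o
    refine ⟨fun h => ⟨h, ?_⟩, fun h => h.1⟩
    have := h.2
    rwa [hdual] at this
  · have h := hdual o
    rw [dual] at h
    rw [model, h]
    rfl

lemma integrable_indicator_of_bound {F : Type*} [NormedAddCommGroup F] {t : ℕ} {f : Ω → F}
    (hf : AEStronglyMeasurable f Pr) {K : ℝ}
    (hK : ∀ o ∈ R.active t, ‖f o‖ ≤ K * ‖(R.z t o).2‖) :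
    Integrable ((R.active t).indicator f) Pr := by
  refine ((R.integrable_outcome t).norm.const_mul K).abs.mono'
    (hf.indicator (R.measurableSet_active t)) (ae_of_all _ fun o => ?_)
  by_cases ho : o ∈ R.active t
  · rw [indicator_of_mem ho]
    exact (hK o ho).trans (le_abs_self _)
  · rw [indicator_of_notMem ho, norm_zero]
    exact abs_nonneg _

lemma integrable_indicator_reward (hζ : 0 < ζ) (t : ℕ) : Integrable ((R.active t).indicator
    fun o => (R.z t o).2.1 (M.decision R.z R.lam R.th t o)) Pr := by
  obtain ⟨K, hK⟩ := p.exists_bound hζ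
  refine R.integrable_indicator_of_bound ?_ fun o ho => (hK _ (R.decision_mem ho) _).1
  have hc : Continuous fun q : StrongDual ℝ W × W => q.1 q.2 := by fun_prop
  exact (hc.measurable.comp ((R.z_meas t).snd.fst.prodMk
    (R.measurable_decision t))).aestronglyMeasurable

lemma integrable_indicator_consumption (hζ : 0 < ζ) (t : ℕ) :
    Integrable ((R.active t).indicator (M.consumption R.z R.lam R.th t)) Pr := by
  borelize E
  obtain ⟨K, hK⟩ := p.exists_bound hζ
  refine R.integrable_indicator_of_bound ?_ fun o ho => (hK _ (R.decision_mem ho) _).2.1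
  exact (M.measurable_consumption (fun i _ => R.z_meas i) (R.measurable_lam t)
    (R.measurable_th t)).aestronglyMeasurable

lemma integrable_indicator_cost (hζ : 0 < ζ) (t : ℕ) : Integrable ((R.active t).indicator
    fun o => cost ζ (R.z t o).2 (R.dual t o) (M.decision R.z R.lam R.th t o)) Pr := by
  obtain ⟨K, hK⟩ := p.exists_bound hζ
  refine R.integrable_indicator_of_bound ?_ fun o ho => (hK _ (R.decision_mem ho) _).2.2 _ ho.2
  have h := (measurable_cost_apply (W := W) (E := E) ζ).comp ((R.z_meas t).snd.prodMk
    ((R.measurable_dual t).prodMk (R.measurable_decision t)))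
  exact Measurable.aestronglyMeasurable (by simpa only [Function.comp_def] using h)

lemma integrable_indicator_of_bounded [IsProbabilityMeasure Pr] {t : ℕ} {f : Ω → ℝ}
    (hf : Measurable f) {K : ℝ} (hK : ∀ o ∈ R.active t, |f o| ≤ K) :
    Integrable ((R.active t).indicator f) Pr := by
  refine Integrable.of_bound (hf.indicator (R.measurableSet_active t)).aestronglyMeasurable |K|
    (ae_of_all _ fun o => ?_)
  by_cases ho : o ∈ R.active t
  · rw [indicator_of_mem ho]
    exact (hK o ho).trans (le_abs_self _)
  · rw [indicator_of_notMem ho, norm_zero]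
    exact abs_nonneg _

lemma measurable_decisionValue_model (t : ℕ) :
    Measurable fun o => M.decisionValue (M.model R.z R.lam R.th t o) (R.dual t o) := by
  obtain ⟨A, ω, g, hA, hω, hg, hact, hdom, hdual, hmodel, herm⟩ := R.exists_factorization t
  simp only [hdual, hmodel]
  exact (M.measurable_decisionValue hg hω).comp (R.measurable_hist t)

lemma measurable_decisionValue_const {g : X → Outcome W E} (hg : Measurable g) (t : ℕ) :
    Measurable fun o => M.decisionValue g (R.dual t o) :=
  M.measurable_decisionValue (g := fun _ => g) (hg.comp measurable_snd) (R.measurable_dual t)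

lemma integrable_indicator_model [IsProbabilityMeasure Pr] (hζ : 0 < ζ) (t : ℕ) :
    Integrable ((R.active t).indicator fun o =>
      M.decisionValue (M.model R.z R.lam R.th t o) (R.dual t o)) Pr := by
  obtain ⟨K, hK⟩ := M.exists_decisionValue_bound hζ
  exact R.integrable_indicator_of_bounded (R.measurable_decisionValue_model t)
    fun o ho => hK _ _ ho.2

lemma integrable_indicator_const [IsProbabilityMeasure Pr] (hζ : 0 < ζ) {g : X → Outcome W E}
    (hg : Measurable g) (t : ℕ) :
    Integrable ((R.active t).indicator fun o => M.decisionValue g (R.dual t o)) Pr := by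
  obtain ⟨K, hK⟩ := M.exists_decisionValue_bound hζ
  exact R.integrable_indicator_of_bounded (R.measurable_decisionValue_const hg t)
    fun o ho => hK _ _ ho.2

lemma integrable_indicator_excess [IsProbabilityMeasure Pr] (hζ : 0 < ζ)
    {gstar : X → Outcome W E} (hgstar : Measurable gstar) (t : ℕ) :
    Integrable ((R.active t).indicator fun o => M.decisionValue gstar (R.dual t o) -
      M.decisionValue (M.model R.z R.lam R.th t o) (R.dual t o)) Pr := by
  rw [indicator_sub]
  exact (R.integrable_indicator_const hζ hgstar t).sub (R.integrable_indicator_model hζ t)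

/-- The conditional expectation of the cost of a round, given the history. -/
lemma integral_indicator_cost [IsProbabilityMeasure Pr] (hζ : 0 < ζ) (t : ℕ) :
    ∫ o, (R.active t).indicator
      (fun o => cost ζ (R.z t o).2 (R.dual t o) (M.decision R.z R.lam R.th t o)) o ∂Pr =
    ∫ o, (R.active t).indicator
      (fun o => M.decisionValue (M.model R.z R.lam R.th t o) (R.dual t o)) o ∂Pr := by
  obtain ⟨A, ω, g, hA, hω, hg, hact, hdom, hdual, hmodel, herm⟩ := R.exists_factorization t
  have hF : Measurable (Function.uncurry fun (D : Fin t → X × Outcome W E) (z : X × Outcome W E) =>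
      A.indicator (fun D => cost ζ z.2 (ω D) (M.wstar (g D z.1) (ω D))) D) := by
    have h1 : Measurable fun q : (Fin t → X × Outcome W E) × (X × Outcome W E) => ω q.1 :=
      hω.comp measurable_fst
    have h2 : Measurable fun q : (Fin t → X × Outcome W E) × (X × Outcome W E) => g q.1 q.2.1 :=
      hg.comp (measurable_fst.prodMk measurable_snd.fst)
    have h3 : Measurable fun q : (Fin t → X × Outcome W E) × (X × Outcome W E) =>
        M.wstar (g q.1 q.2.1) (ω q.1) := M.wstar_meas.comp (h2.prodMk h1)
    have h4 : Measurable fun q : (Fin t → X × Outcome W E) × (X × Outcome W E) => q.2.2 :=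
      measurable_snd.snd
    have h5 := ((measurable_cost_apply (W := W) (E := E) ζ).comp
      (h4.prodMk (h1.prodMk h3))).indicator (measurable_fst hA)
    exact h5
  have hpath : ∀ o, (R.active t).indicator
      (fun o => cost ζ (R.z t o).2 (R.dual t o) (M.decision R.z R.lam R.th t o)) o =
      A.indicator (fun D => cost ζ (R.z t o).2 (ω D) (M.wstar (g D (R.z t o).1) (ω D)))
        (R.hist t o) := fun o => by
    rw [hact]
    by_cases ho : R.hist t o ∈ A
    · rw [indicator_of_mem ho, indicator_of_mem (show o ∈ R.hist t ⁻¹' A from ho), ← hdual,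
        ← hmodel]
      rfl
    · rw [indicator_of_notMem ho, indicator_of_notMem (show o ∉ R.hist t ⁻¹' A from ho)]
  have hval : ∀ o, (R.active t).indicator
      (fun o => M.decisionValue (M.model R.z R.lam R.th t o) (R.dual t o)) o =
      ∫ z, A.indicator (fun D => cost ζ z.2 (ω D) (M.wstar (g D z.1) (ω D)))
        (R.hist t o) ∂(Pr.map (R.z t)) := fun o => by
    rw [hact, R.z_law]
    by_cases ho : R.hist t o ∈ A
    · simp only [indicator_of_mem ho]
      rw [indicator_of_mem (show o ∈ R.hist t ⁻¹' A from ho), hdual, hmodel]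
      rfl
    · simp only [indicator_of_notMem ho]
      rw [indicator_of_notMem (show o ∉ R.hist t ⁻¹' A from ho), integral_zero]
  have hint := R.integrable_indicator_cost hζ t
  have h := (integrable_integral_of_indepFun (R.measurable_hist t) (R.z_meas t) (R.indepFun_hist t)
    hF (hint.congr (ae_of_all _ hpath))).2
  simp only [hpath, hval]
  exact h

/-- The expected excess risk of the model used in round `t ≥ 1`. -/
lemma integral_indicator_excess_le [IsProbabilityMeasure Pr] (hζ : 0 < ζ)
    {gstar : X → Outcome W E} (hgstar : p.IsBayes gstar) {κ α : ℝ}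
    (hκ : 0 ≤ κ) (hrisk : M.ExcessRiskBound gstar κ α) {t : ℕ} (ht : 0 < t) :
    ∫ o, (R.active t).indicator (fun o => M.decisionValue gstar (R.dual t o) -
      M.decisionValue (M.model R.z R.lam R.th t o) (R.dual t o)) o ∂Pr ≤ κ * (t : ℝ) ^ (-α) := by
  obtain ⟨A, ω, g, hA, hω, hg, hact, hdom, hdual, hmodel, herm⟩ := R.exists_factorization t
  set h : (Fin t → X × Outcome W E) → ℝ := A.indicator fun D =>
    M.decisionValue gstar (ω D) - M.decisionValue (g D) (ω D) with hh
  have hgD : ∀ D, Measurable (g D) := fun D => hg.comp measurable_prodMk_left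
  have hmeas : Measurable h := by
    refine Measurable.indicator (Measurable.sub ?_ (M.measurable_decisionValue hg hω)) hA
    exact M.measurable_decisionValue (g := fun _ => gstar) (hgstar.1.comp measurable_snd) hω
  have hpath : ∀ o, (R.active t).indicator (fun o => M.decisionValue gstar (R.dual t o) -
      M.decisionValue (M.model R.z R.lam R.th t o) (R.dual t o)) o = h (R.hist t o) := fun o => by
    rw [hact]
    by_cases ho : R.hist t o ∈ A
    · rw [hh, indicator_of_mem ho, indicator_of_mem (show o ∈ R.hist t ⁻¹' A from ho), hdual,
        hmodel]
    · rw [hh, indicator_of_notMem ho, indicator_of_notMem (show o ∉ R.hist t ⁻¹' A from ho)]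
  have h0 : ∀ D, 0 ≤ h D := fun D => indicator_nonneg (fun D hD =>
    sub_nonneg.2 (M.decisionValue_le hgstar (hgD D) hζ (hdom D hD))) D
  simp only [hpath]
  rw [integral_eq_lintegral_of_nonneg_ae (ae_of_all _ fun o => h0 _)
    (hmeas.comp (R.measurable_hist t)).aestronglyMeasurable]
  refine ENNReal.toReal_le_of_le_ofReal (by positivity) ?_
  rw [← lintegral_map (f := fun D => ENNReal.ofReal (h D)) hmeas.ennreal_ofReal
    (R.measurable_hist t), R.map_hist]
  -- The dual variables depend on the same samples as the risk minimizer; the supremum over `ω`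
  -- inside the expectation handles this.
  refine (lintegral_mono fun D => ?_).trans (hrisk t ht)
  by_cases hD : D ∈ A
  · refine le_iSup₂_of_le (ω D) (hdom D hD) ?_
    rw [hh, indicator_of_mem hD, ← herm ht, M.spoRisk_sub hgstar.1 (hgD D) hζ (hdom D hD)]
  · simp only [hh, indicator_of_notMem hD, ENNReal.ofReal_zero, zero_le]

lemma integral_indicator_excess_zero_le [IsProbabilityMeasure Pr] (hζ : 0 < ζ)
    {gstar : X → Outcome W E} (hgstar : p.IsBayes gstar) {r : ℝ}
    (hinit : M.spoRisk M.g₁ M.init - M.spoRisk gstar M.init ≤ r) :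
    ∫ o, (R.active 0).indicator (fun o => M.decisionValue gstar (R.dual 0 o) -
      M.decisionValue (M.model R.z R.lam R.th 0 o) (R.dual 0 o)) o ∂Pr ≤ r := by
  rw [M.spoRisk_sub hgstar.1 M.g₁_meas hζ M.init_mem] at hinit
  have h0 := sub_nonneg.2 (M.decisionValue_le hgstar M.g₁_meas hζ M.init_mem)
  have hle : ∀ o, (R.active 0).indicator (fun o => M.decisionValue gstar (R.dual 0 o) -
      M.decisionValue (M.model R.z R.lam R.th 0 o) (R.dual 0 o)) o ≤ r := fun o => by
    by_cases ho : o ∈ R.active 0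
    · rw [indicator_of_mem ho]
      simpa [dual, R.lam_zero, R.th_zero, model] using hinit
    · rw [indicator_of_notMem ho]
      exact h0.trans hinit
  simpa using integral_mono (R.integrable_indicator_excess hζ hgstar.1 0) (integrable_const r) hle

lemma integrable_value [IsProbabilityMeasure Pr] (hζ : 0 < ζ) : Integrable R.value Pr := by
  have hr : Integrable (fun o => (T : ℝ)⁻¹ * ∑ t ∈ Finset.range T, (R.active t).indicator
      (fun o => (R.z t o).2.1 (M.decision R.z R.lam R.th t o)) o) Pr :=
    (integrable_finsetSum _ fun t _ => R.integrable_indicator_reward hζ t).const_mul _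
  have hv : Integrable (fun o => (T : ℝ)⁻¹ • ∑ t ∈ Finset.range T, (R.active t).indicator
      (M.consumption R.z R.lam R.th t) o) Pr :=
    (integrable_finsetSum _ fun t _ => R.integrable_indicator_consumption hζ t).smul _
  have hu : Integrable (fun o => p.u ((T : ℝ)⁻¹ • ∑ t ∈ Finset.range T, (R.active t).indicator
      (M.consumption R.z R.lam R.th t) o)) Pr := by
    refine (hv.norm.const_mul p.L).mono'
      (p.lipschitz_u.continuous.comp_aestronglyMeasurable hv.1) (ae_of_all _ fun o => ?_)
    have := p.lipschitz_u.dist_le_mul ((T : ℝ)⁻¹ • ∑ t ∈ Finset.range T,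
      (R.active t).indicator (M.consumption R.z R.lam R.th t) o) 0
    rwa [p.u_zero, dist_zero_right, dist_zero_right] at this
  refine (hr.add hu).congr ?_
  filter_upwards [R.ae_active] with o ho
  have h1 := R.sum_range_tau ho fun t o => (R.z t o).2.1 (M.decision R.z R.lam R.th t o)
  have h2 := R.sum_range_tau ho (M.consumption R.z R.lam R.th)
  simp only [Pi.add_apply]
  rw [← h1, ← h2]
  rfl

end

end Run

end Method

lemma Method.Run.mul_OPT_sub_le {X W E Ω : Type*} [MeasurableSpace X]
    [NormedAddCommGroup W] [NormedSpace ℝ W] [FiniteDimensional ℝ W]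
    [MeasurableSpace W] [BorelSpace W]
    [NormedAddCommGroup E] [NormedSpace ℝ E] [FiniteDimensional ℝ E]
    {p : Problem X W E} {ζ : ℝ} (hζ : 0 < ζ) {M : Method p ζ}
    {gstar : X → Outcome W E} (hgstar : p.IsBayes gstar)
    {DLam DTh GLam GTh : ℝ}
    (hDLam : ∀ y₁ ∈ p.LamDom, ∀ y₂ ∈ p.LamDom, bregman p.LamDom M.hLam y₁ y₂ ≤ DLam)
    (hDTh : ∀ y₁ ∈ p.ThDom, ∀ y₂ ∈ p.ThDom, bregman p.ThDom M.hTh y₁ y₂ ≤ DTh)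
    (hGLam : 0 < GLam) (hGTh : 0 < GTh) (hfeas : ∃ π, p.IsFeasiblePolicy π)
    (hOPT : ENNReal.ofReal p.OPT / boundaryDist p.V ≤ ENNReal.ofReal ζ)
    {T : ℕ} (hT : 0 < T) [MeasurableSpace Ω] {Pr : Measure Ω} [IsProbabilityMeasure Pr]
    (R : M.Run T (√DLam / (GLam * √T)) (√DTh / (GTh * √T)) Pr)
    (hsubLam : ∀ᵐ o ∂Pr, ∀ t < R.tau o, ‖R.subLam t o‖ ≤ GLam)
    (hsubTh : ∀ᵐ o ∂Pr, ∀ t < R.tau o, ‖R.subTh t o‖ ≤ GTh) :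
    T * p.OPT - T * ∫ o, R.value o ∂Pr ≤
      ∑ t ∈ Finset.range T, ∫ o, (R.active t).indicator
        (fun o => M.decisionValue gstar (R.dual t o) -
          M.decisionValue (M.model R.z R.lam R.th t o) (R.dual t o)) o ∂Pr +
      (3 / 2 * (GLam * √DLam * √T) + ζ * (3 / 2 * (GTh * √DTh * √T))) := by
  set B := 3 / 2 * (GLam * √DLam * √T) + ζ * (3 / 2 * (GTh * √DTh * √T)) with hB
  have hTr : (T : ℝ) ≠ 0 := Nat.cast_ne_zero.2 hT.ne'
  have hpath : ∀ᵐ o ∂Pr, T * p.OPT ≤ (∑ t ∈ Finset.range T,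
      ((R.active t).indicator (fun o => M.decisionValue gstar (R.dual t o) -
          M.decisionValue (M.model R.z R.lam R.th t o) (R.dual t o)) o +
        (R.active t).indicator (fun o =>
          M.decisionValue (M.model R.z R.lam R.th t o) (R.dual t o)) o -
        (R.active t).indicator (fun o =>
          cost ζ (R.z t o).2 (R.dual t o) (M.decision R.z R.lam R.th t o)) o)) +
      T * R.value o + B := by
    filter_upwards [R.ae_active, R.subLam_mem, R.subTh_mem, R.lam_step, R.th_step, hsubLam,
      hsubTh] with o ho h1 h2 h3 h4 h5 h6
    have h7 := p.mul_OPT_le_of_path hζ hOPT M.mirror_Lam M.mirror_Th hGLam hGTh hDLam hDTh hT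
      (b := fun t => M.decisionValue gstar (R.dual t o)) h1 h2 h3 h4 h5 h6
      (fun t ht => M.OPT_le hgstar hζ hfeas ((ho t).1 ht).2)
    have h8 := R.sum_range_tau ho fun t o => (M.decisionValue gstar (R.dual t o) -
      M.decisionValue (M.model R.z R.lam R.th t o) (R.dual t o)) +
      M.decisionValue (M.model R.z R.lam R.th t o) (R.dual t o) -
      cost ζ (R.z t o).2 (R.dual t o) (M.decision R.z R.lam R.th t o)
    simp only [indicator_sub, indicator_add] at h8
    simp only [indicator_sub]
    rw [← h8]
    have h9 : T * R.value o =
        ∑ t ∈ Finset.range (R.tau o), (R.z t o).2.1 (M.decision R.z R.lam R.th t o) +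
        T * p.u ((T : ℝ)⁻¹ • ∑ t ∈ Finset.range (R.tau o), M.consumption R.z R.lam R.th t o) := by
      rw [Run.value, mul_add, rAvg, mul_inv_cancel_left₀ hTr]
      rfl
    have h10 : ∑ t ∈ Finset.range (R.tau o), (M.decisionValue gstar (R.dual t o) +
        R.lam t o (M.consumption R.z R.lam R.th t o) +
        ζ * R.th t o (M.consumption R.z R.lam R.th t o)) =
      ∑ t ∈ Finset.range (R.tau o), (M.decisionValue gstar (R.dual t o) -
        M.decisionValue (M.model R.z R.lam R.th t o) (R.dual t o) +
        M.decisionValue (M.model R.z R.lam R.th t o) (R.dual t o) -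
        cost ζ (R.z t o).2 (R.dual t o) (M.decision R.z R.lam R.th t o)) +
      ∑ t ∈ Finset.range (R.tau o), (R.z t o).2.1 (M.decision R.z R.lam R.th t o) := by
      rw [← Finset.sum_add_distrib]
      refine Finset.sum_congr rfl fun t _ => ?_
      rw [cost_apply]
      simp only [consumption, dual]
      ring
    change (T : ℝ) * p.OPT ≤ Finset.sum (Finset.range (R.tau o)) _ +
      T * p.u ((T : ℝ)⁻¹ • Finset.sum (Finset.range (R.tau o)) _) + _ at h7
    rw [h10] at h7
    linarith
  have hY := fun t => R.integrable_indicator_excess hζ hgstar.1 t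
  have hP := fun t => R.integrable_indicator_model hζ t
  have hC := fun t => R.integrable_indicator_cost hζ t
  have hYPC := fun t => ((hY t).add (hP t)).sub (hC t)
  have hS := integrable_finsetSum (Finset.range T) fun t _ => hYPC t
  have hV := (R.integrable_value hζ).const_mul (T : ℝ)
  have h1 := integral_mono_ae (integrable_const _) ((hS.add hV).add (integrable_const B)) hpath
  simp only [Pi.add_apply, Pi.sub_apply] at h1
  rw [integral_const, probReal_univ, one_smul] at h1
  have h2 : ∫ o, ((∑ t ∈ Finset.range T,
      ((R.active t).indicator (fun o => M.decisionValue gstar (R.dual t o) -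
          M.decisionValue (M.model R.z R.lam R.th t o) (R.dual t o)) o +
        (R.active t).indicator (fun o =>
          M.decisionValue (M.model R.z R.lam R.th t o) (R.dual t o)) o -
        (R.active t).indicator (fun o =>
          cost ζ (R.z t o).2 (R.dual t o) (M.decision R.z R.lam R.th t o)) o)) +
      T * R.value o + B) ∂Pr = (∑ t ∈ Finset.range T, ∫ o, (R.active t).indicator
        (fun o => M.decisionValue gstar (R.dual t o) -
          M.decisionValue (M.model R.z R.lam R.th t o) (R.dual t o)) o ∂Pr) +
      T * ∫ o, R.value o ∂Pr + B := by
    have e1 := integral_add (hS.add hV) (integrable_const (μ := Pr) B)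
    have e2 := integral_add hS hV
    have e3 := integral_finsetSum (Finset.range T) fun t _ => hYPC t
    simp only [Pi.add_apply, Pi.sub_apply] at e1 e2 e3
    rw [e1, e2, e3, integral_const, probReal_univ, one_smul, integral_const_mul]
    congr 2
    refine Finset.sum_congr rfl fun t _ => ?_
    have e4 := integral_sub ((hY t).add (hP t)) (hC t)
    have e5 := integral_add (hY t) (hP t)
    simp only [Pi.add_apply] at e4 e5
    rw [e4, e5, R.integral_indicator_cost hζ t, add_sub_cancel_right]
  rw [h2] at h1
  linarith

section Rates

lemma sum_rpow_neg_le {β : ℝ} (h0 : 0 < β) (h1 : β < 1) (n : ℕ) :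
    ∑ t ∈ Finset.range n, ((t : ℝ) + 1) ^ (-β) ≤ (n : ℝ) ^ (1 - β) / (1 - β) := by
  have hβ : 0 < 1 - β := by linarith
  induction n with
  | zero => simp [Real.zero_rpow hβ.ne']
  | succ n ih =>
    rw [Finset.sum_range_succ, Nat.cast_succ]
    have hn : (0 : ℝ) < n + 1 := by positivity
    have hb := rpow_one_add_le_one_add_mul_self (s := -(1 / ((n : ℝ) + 1))) (p := 1 - β)
      (by rw [neg_le_neg_iff, div_le_one hn]; linarith [(Nat.cast_nonneg n : (0 : ℝ) ≤ n)])
      hβ.le (by linarith)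
    have e1 : 1 + -(1 / ((n : ℝ) + 1)) = n / (n + 1) := by field_simp; ring
    rw [e1, Real.div_rpow (Nat.cast_nonneg n) hn.le, div_le_iff₀ (Real.rpow_pos_of_pos hn _)] at hb
    have e2 : ((n : ℝ) + 1) ^ (-β) = ((n : ℝ) + 1) ^ (1 - β) / (n + 1) := by
      rw [← Real.rpow_sub_one hn.ne']; congr 1; ring
    rw [le_div_iff₀ hβ] at ih ⊢
    rw [add_mul, e2]
    have e3 : (1 + (1 - β) * -(1 / ((n : ℝ) + 1))) * ((n : ℝ) + 1) ^ (1 - β) =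
      ((n : ℝ) + 1) ^ (1 - β) - ((n : ℝ) + 1) ^ (1 - β) / (n + 1) * (1 - β) := by field_simp; ring
    linarith

lemma excess_sum_le {α c κ κ' : ℝ} (hα : 0 < α) (hc : 0 ≤ c) (hκ : 0 < κ) (hκ' : 0 ≤ κ')
    (h : α < 1 ∨ κ ≤ c * κ') (n : ℕ) :
    ∑ t ∈ Finset.range n, κ * ((t : ℝ) + 1) ^ (-α) + c * κ ≤
      ((n : ℝ) + 1) * (κ' * (c * (c + 2) * ((n : ℝ) + 1) ^ (-(1 / 2) : ℝ)) +
        κ * ((c + |(1 - α)⁻¹|) * ((n : ℝ) + 1) ^ (-α))) := by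
  rw [← Finset.mul_sum]
  have hn : (0 : ℝ) < n + 1 := by positivity
  have hn1 : (1 : ℝ) ≤ n + 1 := by linarith [(Nat.cast_nonneg n : (0 : ℝ) ≤ n)]
  have hpow : ∀ β : ℝ, ((n : ℝ) + 1) * ((n : ℝ) + 1) ^ (-β) = ((n : ℝ) + 1) ^ (1 - β) := by
    intro β
    rw [sub_eq_add_neg, Real.rpow_add hn, Real.rpow_one]
  have hsum : ∀ {β : ℝ}, 0 < β → β < 1 → ∑ t ∈ Finset.range n, ((t : ℝ) + 1) ^ (-β) ≤
      ((n : ℝ) + 1) ^ (1 - β) * (1 - β)⁻¹ := by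
    intro β h0 h1
    have hβ : 0 < 1 - β := by linarith
    refine (sum_rpow_neg_le h0 h1 n).trans ?_
    rw [div_eq_mul_inv]
    exact mul_le_mul_of_nonneg_right (Real.rpow_le_rpow (Nat.cast_nonneg n) (by linarith) hβ.le)
      (inv_nonneg.2 hβ.le)
  have hexp : ((n : ℝ) + 1) * (κ' * (c * (c + 2) * ((n : ℝ) + 1) ^ (-(1 / 2) : ℝ)) +
        κ * ((c + |(1 - α)⁻¹|) * ((n : ℝ) + 1) ^ (-α))) =
      κ' * (c * (c + 2)) * ((n : ℝ) + 1) ^ (1 - 1 / 2 : ℝ) +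
        κ * (c + |(1 - α)⁻¹|) * ((n : ℝ) + 1) ^ (1 - α) := by
    rw [← hpow (1 / 2), ← hpow α]; ring
  rw [hexp]
  have hp1 := Real.rpow_pos_of_pos hn (1 - α)
  have hp2 := Real.rpow_pos_of_pos hn (1 - 1 / 2 : ℝ)
  rcases lt_or_ge α 1 with h1 | h1
  · have h2 := hsum hα h1
    have h3 : 1 ≤ ((n : ℝ) + 1) ^ (1 - α) := Real.one_le_rpow hn1 (by linarith)
    rw [abs_of_pos (inv_pos.2 (by linarith : 0 < 1 - α))]
    have h4 : 0 ≤ κ' * (c * (c + 2)) * ((n : ℝ) + 1) ^ (1 - 1 / 2 : ℝ) := by positivity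
    have h5 := mul_le_mul_of_nonneg_left h2 hκ.le
    have h6 := mul_le_mul_of_nonneg_left h3 (mul_nonneg hκ.le hc)
    nlinarith
  · have hκc : κ ≤ c * κ' := h.resolve_left (not_lt.2 h1)
    have h2 := hsum (β := 1 / 2) (by norm_num) (by norm_num)
    have h3 : 1 ≤ ((n : ℝ) + 1) ^ (1 - 1 / 2 : ℝ) := Real.one_le_rpow hn1 (by norm_num)
    have h4 : ∑ t ∈ Finset.range n, ((t : ℝ) + 1) ^ (-α) ≤
        ∑ t ∈ Finset.range n, ((t : ℝ) + 1) ^ (-(1 / 2) : ℝ) := by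
      refine Finset.sum_le_sum fun t _ => Real.rpow_le_rpow_of_exponent_le ?_ (by linarith)
      linarith [(Nat.cast_nonneg t : (0 : ℝ) ≤ t)]
    have h5 : 0 ≤ κ * (c + |(1 - α)⁻¹|) * ((n : ℝ) + 1) ^ (1 - α) := by positivity
    have e : (1 - 1 / 2 : ℝ)⁻¹ = 2 := by norm_num
    rw [e] at h2
    have h6 := mul_le_mul_of_nonneg_left (h4.trans h2) hκ.le
    have h7 := mul_le_mul_of_nonneg_left h3 (mul_nonneg hκ.le hc)
    have h8 : κ * ((c + 2) * ((n : ℝ) + 1) ^ (1 - 1 / 2 : ℝ)) ≤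
        c * κ' * ((c + 2) * ((n : ℝ) + 1) ^ (1 - 1 / 2 : ℝ)) :=
      mul_le_mul_of_nonneg_right hκc (by positivity)
    nlinarith

lemma regret_le {c Dv ζ DLam DTh GLam GTh T : ℝ} (hζ : 0 < ζ) (hGLam : GLam ≤ c * Dv)
    (hGTh : GTh ≤ c * Dv) (hT : 0 < T) :
    3 / 2 * (GLam * √DLam * √T) + ζ * (3 / 2 * (GTh * √DTh * √T)) ≤
      T * (kappaMD Dv ζ DLam DTh * (3 / 2 * c * T ^ (-(1 / 2) : ℝ))) := by
  have h1 : T * T ^ (-(1 / 2) : ℝ) = √T := by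
    rw [Real.sqrt_eq_rpow]
    nth_rewrite 1 [← Real.rpow_one T]
    rw [← Real.rpow_add hT]; norm_num
  have h2 : GLam * (√DLam * √T) ≤ c * Dv * (√DLam * √T) :=
    mul_le_mul_of_nonneg_right hGLam (by positivity)
  have h3 : ζ * (GTh * (√DTh * √T)) ≤ ζ * (c * Dv * (√DTh * √T)) :=
    mul_le_mul_of_nonneg_left (mul_le_mul_of_nonneg_right hGTh (by positivity)) hζ.le
  have h4 : T * (kappaMD Dv ζ DLam DTh * (3 / 2 * c * T ^ (-(1 / 2) : ℝ))) =
      kappaMD Dv ζ DLam DTh * (3 / 2 * c * √T) := by rw [← h1]; ring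
  rw [h4, kappaMD]
  nlinarith

end Rates

end OnlineSPO

theorem theorem1 (α c : ℝ) (hα : 0 < α) :
    ∃ C : ℝ, ∀ {X W E Ω : Type*} [MeasurableSpace X]
      [NormedAddCommGroup W] [NormedSpace ℝ W] [FiniteDimensional ℝ W]
      [MeasurableSpace W] [BorelSpace W]
      [NormedAddCommGroup E] [NormedSpace ℝ E] [FiniteDimensional ℝ E]
      (p : OnlineSPO.Problem X W E) (ζ : ℝ) (_hζ : 0 < ζ) (M : OnlineSPO.Method p ζ)
      (gstar : X → OnlineSPO.Outcome W E) (_hgstar : p.IsBayes gstar)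
      -- excess risk bound, also for the initial model up to the factor `c`
      (κrisk : ℝ) (_hκ : 0 < κrisk) (_hrisk : M.ExcessRiskBound gstar κrisk α)
      (_hinit : M.spoRisk M.g₁ M.init - M.spoRisk gstar M.init ≤ c * κrisk)
      -- bounded consumption
      (Dv : ℝ) (_hDv : 1 ≤ Dv) (_hbdd : p.BoundedConsumption Dv)
      -- bounds on the Bregman distances and on the norms of the subgradients
      (DLam DTh GLam GTh : ℝ)
      (_hDLam : ∀ y₁ ∈ p.LamDom, ∀ y₂ ∈ p.LamDom, OnlineSPO.bregman p.LamDom M.hLam y₁ y₂ ≤ DLam)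
      (_hDTh : ∀ y₁ ∈ p.ThDom, ∀ y₂ ∈ p.ThDom, OnlineSPO.bregman p.ThDom M.hTh y₁ y₂ ≤ DTh)
      (_hGLam : 0 < GLam) (_hGTh : 0 < GTh) (_hGLam' : GLam ≤ c * Dv) (_hGTh' : GTh ≤ c * Dv)
      (_hα1 : α < 1 ∨ κrisk ≤ c * OnlineSPO.kappaMD Dv ζ DLam DTh)
      -- the benchmark and the penalty parameter
      (_hfeas : ∃ π, p.IsFeasiblePolicy π)
      (_hOPT : ENNReal.ofReal p.OPT / OnlineSPO.boundaryDist p.V ≤ ENNReal.ofReal ζ)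
      -- the run of the algorithm
      (T : ℕ) (_hT : 0 < T) [MeasurableSpace Ω] (Pr : MeasureTheory.Measure Ω)
      [MeasureTheory.IsProbabilityMeasure Pr]
      (R : M.Run T (√DLam / (GLam * √T)) (√DTh / (GTh * √T)) Pr)
      (_hsubLam : ∀ᵐ o ∂Pr, ∀ t < R.tau o, ‖R.subLam t o‖ ≤ GLam)
      (_hsubTh : ∀ᵐ o ∂Pr, ∀ t < R.tau o, ‖R.subTh t o‖ ≤ GTh),
      MeasureTheory.Integrable R.value Pr ∧
        p.OPT - ∫ o, R.value o ∂Pr ≤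
          OnlineSPO.kappaMD Dv ζ DLam DTh * (C * (T : ℝ) ^ (-(1 / 2) : ℝ)) +
            κrisk * (C * (T : ℝ) ^ (-α)) := by
  refine ⟨3 / 2 * c + (c * (c + 2) + (c + |(1 - α)⁻¹|)), ?_⟩
  intro X W E Ω _ _ _ _ _ _ _ _ _ p ζ hζ M gstar hgstar κ hκ hrisk hinit Dv hDv _ DLam DTh GLam GTh
    hDLam hDTh hGLam hGTh hGLam' hGTh' hα1 hfeas hOPT T hT _ Pr _ R hsubLam hsubTh
  refine ⟨R.integrable_value hζ, ?_⟩
  have hc : 0 < c := pos_of_mul_pos_left (hGLam.trans_le hGLam') (by linarith)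
  have hκ' : 0 ≤ OnlineSPO.kappaMD Dv ζ DLam DTh := by
    unfold OnlineSPO.kappaMD
    have : 0 ≤ Dv := by linarith
    positivity
  obtain ⟨n, rfl⟩ := Nat.exists_eq_succ_of_ne_zero hT.ne'
  have hTr : (0 : ℝ) < (n.succ : ℕ) := Nat.cast_pos.2 hT
  have h1 := OnlineSPO.Method.Run.mul_OPT_sub_le hζ hgstar hDLam hDTh hGLam hGTh hfeas hOPT hT R
    hsubLam hsubTh
  have h2 := OnlineSPO.regret_le (DLam := DLam) (DTh := DTh) hζ hGLam' hGTh' hTr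
  have h3 := OnlineSPO.excess_sum_le hα hc.le hκ hκ' hα1 n
  have h4 : ∀ t ∈ Finset.range n, ∫ o, (R.active (t + 1)).indicator
      (fun o => M.decisionValue gstar (R.dual (t + 1) o) -
        M.decisionValue (M.model R.z R.lam R.th (t + 1) o) (R.dual (t + 1) o)) o ∂Pr ≤
      κ * ((t : ℝ) + 1) ^ (-α) := fun t _ => by
    simpa using R.integral_indicator_excess_le hζ hgstar hκ.le hrisk t.succ_pos
  have h5 := Finset.sum_le_sum h4
  have h6 := R.integral_indicator_excess_zero_le hζ hgstar hinit
  rw [Finset.sum_range_succ'] at h1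
  rw [← Nat.cast_succ] at h3
  have hp1 : 0 ≤ ((n.succ : ℕ) : ℝ) ^ (-(1 / 2) : ℝ) := by positivity
  have hp2 : 0 ≤ ((n.succ : ℕ) : ℝ) ^ (-α) := by positivity
  have h7 : OnlineSPO.kappaMD Dv ζ DLam DTh * (3 / 2 * c * ((n.succ : ℕ) : ℝ) ^ (-(1 / 2) : ℝ)) +
      (OnlineSPO.kappaMD Dv ζ DLam DTh * (c * (c + 2) * ((n.succ : ℕ) : ℝ) ^ (-(1 / 2) : ℝ)) +
        κ * ((c + |(1 - α)⁻¹|) * ((n.succ : ℕ) : ℝ) ^ (-α))) ≤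
      OnlineSPO.kappaMD Dv ζ DLam DTh * ((3 / 2 * c + (c * (c + 2) + (c + |(1 - α)⁻¹|))) *
        ((n.succ : ℕ) : ℝ) ^ (-(1 / 2) : ℝ)) +
      κ * ((3 / 2 * c + (c * (c + 2) + (c + |(1 - α)⁻¹|))) * ((n.succ : ℕ) : ℝ) ^ (-α)) := by
    have e1 : 0 ≤ OnlineSPO.kappaMD Dv ζ DLam DTh * ((c + |(1 - α)⁻¹|) *
        ((n.succ : ℕ) : ℝ) ^ (-(1 / 2) : ℝ)) := by positivity
    have e2 : 0 ≤ κ * ((3 / 2 * c + c * (c + 2)) * ((n.succ : ℕ) : ℝ) ^ (-α)) := by positivity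
    linarith
  refine le_trans ?_ h7
  refine le_of_mul_le_mul_left ?_ hTr
  linarith
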